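/- **Setting.** Consider the spin-$\tfrac12$ chain on $\mathbb Z$ with Pauli letters $I,X,Y,Z$ on each site. For $M\ge 1$ let $\mathcal T_M$ be the complex space of formal sums $Q=\sum_{j\in\mathbb Z}q_j$, where $q_j$ is the translate by $j$ of a local operator $q_0$ which is a linear combination of Pauli strings on the sites $0,\dots,M-1$ whose letter on site $0$ is not $I$. The intensive Frobenius inner product is $\langle Q,Q'\rangle=\mathrm{Tr}(q_0^\dagger q_0')/\mathrm{Tr}(I^{\otimes M})$, with norm $\|\cdot\|_F$, and $\mathrm{ad}_A(O)=[A,O]$ on $\bigcup_M\mathcal T_M$. Let $n\ge 1$, $\Gamma>0$, and let $H_0\in\mathcal T_1$, $T\in\mathcal T_2$ be Hermitian with $\|H_0\|_F=\|T\|_F=\Gamma$. Put $V_1=T$ and, for $m\ge 2$, $$V_m=\sum_{p=2}^m\ \sum_{[k_1,\dots,k_p]=m}\mathfrak f(k_1,\dots,k_p)\,i\,\mathrm{ad}_{S_{k_p}}\cdots i\,\mathrm{ad}_{S_{k_1}}(H_0)+\sum_{p=1}^{m-1}\ \sum_{[k_1,\dots,k_p]=m-1}\mathfrak f(k_1,\dots,k_p)\,i\,\mathrm{ad}_{S_{k_p}}\cdots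 i\,\mathrm{ad}_{S_{k_1}}(T),$$ where $[k_1,\dots,k_p]=m$ means $1\le k_i\le n$ and $k_1+\cdots+k_p=m$, and where $\mathfrak f(k_1,\dots,k_p)=1/\prod_{l=1}^n\mathrm{card}\{i:k_i=l\}!$ if $k_1\le\cdots\le k_p$ and $\mathfrak f=0$ otherwise. For $1\le m\le n$ the generator is $iS_m=[\mathrm{ad}_{H_0}]^{-1}V_m$, where $[\mathrm{ad}_{H_0}]^{-1}$ is the pseudoinverse of $\mathrm{ad}_{H_0}$ for the Frobenius inner product. Let $U=e^{-i\epsilon S_1}e^{-i\epsilon^2S_2}\cdots e^{-i\epsilon^nS_n}$, $H'=U^\dagger(H_0+\epsilon T)U$, $H_{>n}=\sum_{m>n}\epsilon^mV_m$ and $\rho_n=\dfrac1{263\,n^2}$. **Theorem.** 1. The generators are well defined: for $1\le m\le n$, $S_m$ is Hermitian, $iS_m$ is the value at $V_m$ of the pseudoinverse of $\mathrm{ad}_{H_0}$, and $i\,\mathrm{ad}_{S_m}(H_0)+V_m$ commutes with $H_0$. As a formal power series in $\epsilon$, $H'=H_0+\sum_{m=1}^n\epsilon^m\,[\,i\,\mathrm{ad}_{S_m}(H_0)+V_m\,]+\sum_{m>n}\epsilon^mV_m$.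 2. For all $m>n$, $\|V_m\|_F\le\Gamma\rho_n^{-m}$. 3. If $\epsilon\ge 0$ and $\epsilon/\rho_n\le\frac12$, then the series $H_{>n}$ converges in the Hilbert space $\overline{\bigcup_M\mathcal T_M}$, and $$\|H_{>n}\|_F\le 2\Gamma\left(\frac{\epsilon}{\rho_n}\right)^{n+1}=2\Gamma\,(263\,n^2\epsilon)^{n+1}.$$ In particular, for fixed $n$, $\|H_{>n}\|_F=\mathcal O\big((n^2\epsilon)^{n+1}\big)$ as $\epsilon\to0^+$. -/

import Mathlib

/-! ## Translation-invariant local operators of an infinite spin-1/2 chain -/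

/-- The four letters of the Pauli basis on one site. -/
inductive Pauli where
  | I | X | Y | Z
  deriving DecidableEq

namespace Pauli

/-- The identity letter plays the role of the zero of finitely supported functions. -/
instance : Zero Pauli := ⟨I⟩

/-- The Pauli matrices. -/
noncomputable def mat : Pauli → Matrix (Fin 2) (Fin 2) ℂ
  | I => !![1, 0; 0, 1]
  | X => !![0, 1; 1, 0]
  | Y => !![0, -Complex.I; Complex.I, 0]
  | Z => !![1, 0; 0, -1]

/-- The letter of the product of two Pauli matrices. -/
def mul : Pauli → Pauli → Pauli
  | I, b => b
  | a, I => a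
  | X, X => I
  | X, Y => Z
  | X, Z => Y
  | Y, X => Z
  | Y, Y => I
  | Y, Z => X
  | Z, X => Y
  | Z, Y => X
  | Z, Z => I

/-- The scalar of the product of two Pauli matrices. -/
noncomputable def phase : Pauli → Pauli → ℂ
  | X, Y => Complex.I
  | Y, Z => Complex.I
  | Z, X => Complex.I
  | Y, X => -Complex.I
  | Z, Y => -Complex.I
  | X, Z => -Complex.I
  | _, _ => 1

/-- The tables `mul` and `phase` describe the product of the Pauli matrices. -/
theorem mat_mul_mat (a b : Pauli) : a.mat * b.mat = phase a b • (mul a b).mat := by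
  cases a <;> cases b <;> ext i j <;> fin_cases i <;> fin_cases j <;>
    simp [mat, mul, phase, Matrix.mul_apply]

/-- The Pauli matrices are orthonormal for the normalized trace form. -/
theorem trace_mat (a b : Pauli) :
    ∑ i, ∑ j, star (a.mat j i) * b.mat j i = if a = b then 2 else 0 := by
  cases a <;> cases b <;> simp [mat, Fin.sum_univ_two] <;> norm_num

theorem mul_zero_zero : mul 0 0 = 0 := rfl

end Pauli

/-- Pauli strings on the chain `ℤ`: all but finitely many letters are the identity. -/
abbrev PauliString : Type := ℤ →₀ Pauli

namespace PauliString

/-- Translation by `j` sites: `(shift j s) x = s (x - j)`. -/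
noncomputable def shift (j : ℤ) (s : PauliString) : PauliString :=
  Finsupp.equivMapDomain (Equiv.addRight j) s

theorem shift_apply (j : ℤ) (s : PauliString) (x : ℤ) : shift j s x = s (x - j) := by
  simp [shift, Finsupp.equivMapDomain_apply, sub_eq_add_neg]

/-- The Pauli string of the product of two Pauli strings. -/
noncomputable def mul (s t : PauliString) : PauliString :=
  Finsupp.zipWith Pauli.mul Pauli.mul_zero_zero s t

/-- The scalar of the product of two Pauli strings: `s t = phase s t • mul s t`. -/
noncomputable def phase (s t : PauliString) : ℂ :=
  ∏ j ∈ s.support ∩ t.support, Pauli.phase (s j) (t j)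

end PauliString

/-- Gauge-fixed Pauli strings: the first nontrivial letter sits on the site `0`. -/
abbrev GaugedString : Type :=
  {s : PauliString // s 0 ≠ 0 ∧ ∀ j < 0, s j = 0}

/-- Traceless translation-invariant operators of finite range on the chain. The element `q`
stands for the formal sum `∑_{j ∈ ℤ} q_j` of the translates of the gauge-fixed local operator
`∑ a, q a • a`, a linear combination of gauge-fixed Pauli strings. -/
abbrev TIOp : Type := GaugedString →₀ ℂ

namespace TIOp

/-- The operators of maximum range `M`: those whose gauge-fixed local piece is supported on the
sites `0, …, M - 1`. -/
def ofRange (M : ℕ) : Submodule ℂ TIOp :=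
  Finsupp.supported ℂ ℂ {a : GaugedString | ∀ j : ℤ, (M : ℤ) ≤ j → a.1 j = 0}

/-- Hermitian operators: the coefficients in the Pauli string basis are real. -/
def IsHermitian (q : TIOp) : Prop := ∀ a, star (q a) = q a

open Classical in
/-- The operator `∑_{j ∈ ℤ} τ_j u` of a single Pauli string `u`, gauge-fixed by moving the first
nontrivial letter of `u` to the site `0`. The identity string is sent to `0`; it never occurs with
a nonzero coefficient in a commutator. -/
noncomputable def ofString (u : PauliString) : TIOp :=
  if h : u.support.Nonempty then
    Finsupp.single
      ⟨PauliString.shift (-(u.support.min' h)) u, by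
        constructor
        · rw [PauliString.shift_apply]
          simpa using Finsupp.mem_support_iff.mp (u.support.min'_mem h)
        · intro j hj
          rw [PauliString.shift_apply]
          by_contra hne
          have := u.support.min'_le _ (Finsupp.mem_support_iff.mpr hne)
          omega⟩ 1
  else 0

/-- The commutator of two Pauli strings, summed over all translates. Note that `mul s t` and
`mul t s` are the same string. -/
noncomputable def stringComm (s t : PauliString) : TIOp :=
  (PauliString.phase s t - PauliString.phase t s) • ofString (PauliString.mul s t)

/-- The commutator `[∑_j τ_j a, ∑_k τ_k b] = ∑_k τ_k (∑_j [τ_j a, b])`, where only those `j` matter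
for which the supports of `τ_j a` and `b` meet. -/
noncomputable def basisComm (a b : GaugedString) : TIOp :=
  ∑ j ∈ (b.1.support ×ˢ a.1.support).image (fun p => p.1 - p.2),
    stringComm (PauliString.shift j a.1) b.1

/-- The superoperator `ad_A (O) = [A, O]`, as a bilinear map. -/
noncomputable def ad : TIOp →ₗ[ℂ] Module.End ℂ TIOp :=
  Finsupp.linearCombination ℂ fun a =>
    (Finsupp.linearCombination ℂ fun b => basisComm a b : TIOp →ₗ[ℂ] TIOp)

/-- The superoperator `i ad_A`. -/
noncomputable def iad (A : TIOp) : Module.End ℂ TIOp := Complex.I • ad A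

end TIOp

/-! ## The intensive Frobenius inner product -/

/-- The Hilbert space of the intensive Frobenius inner product, that is, the norm closure of the
space of all finite-range operators. The gauge-fixed Pauli strings are an orthonormal basis. -/
abbrev OpHilbert : Type := lp (fun _ : GaugedString => ℂ) 2

namespace TIOp

/-- The embedding of the finite-range operators in the Hilbert space. The intensive Frobenius norm
of `q` is `‖toHilbert q‖`. -/
noncomputable def toHilbert : TIOp →ₗ[ℂ] OpHilbert where
  toFun q := ⟨fun a => q a, (memℓp_zero q.hasFiniteSupport).of_exponent_ge (zero_le)⟩
  map_add' _ _ := rfl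
  map_smul' _ _ := rfl

theorem toHilbert_apply (q : TIOp) (a : GaugedString) : toHilbert q a = q a := rfl

/-- The gauge-fixed local piece of `q` as a matrix on the sites `0, …, M - 1`. -/
noncomputable def localMatrix (M : ℕ) (q : TIOp) :
    Matrix (Fin M → Fin 2) (Fin M → Fin 2) ℂ :=
  ∑ a ∈ q.support, q a • Matrix.of fun x y => ∏ i : Fin M, (a.1 (i : ℤ)).mat (x i) (y i)

theorem trace_stringMatrix (M : ℕ) (a b : Fin M → Pauli) :
    ((Matrix.of fun x y : Fin M → Fin 2 => ∏ i, (a i).mat (x i) (y i)).conjTranspose *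
      (Matrix.of fun x y : Fin M → Fin 2 => ∏ i, (b i).mat (x i) (y i))).trace =
      if a = b then (2 : ℂ) ^ M else 0 := by
  have h : ∏ i, (∑ x, ∑ y, star ((a i).mat y x) * (b i).mat y x) =
      ∏ i, (if a i = b i then (2 : ℂ) else 0) :=
    Finset.prod_congr rfl fun i _ => Pauli.trace_mat _ _
  have h2 : ∏ i : Fin M, (if a i = b i then (2 : ℂ) else 0) =
      if a = b then (2 : ℂ) ^ M else 0 := by
    split_ifs with hab
    · subst hab
      simp
    · obtain ⟨i, hi⟩ := Function.ne_iff.mp hab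
      exact Finset.prod_eq_zero (Finset.mem_univ i) (by simp [hi])
  rw [← h2, ← h, Finset.prod_univ_sum, Fintype.piFinset_univ]
  simp only [Matrix.trace, Matrix.diag_apply, Matrix.mul_apply, Matrix.conjTranspose_apply,
    Matrix.of_apply, Finset.prod_univ_sum, Fintype.piFinset_univ, star_prod,
    Finset.prod_mul_distrib]

/-- For operators of maximum range `M` the inner product is `Tr (q† q') / Tr 1`, computed with the
gauge-fixed local pieces on `M` sites. -/
theorem inner_toHilbert_eq_trace (M : ℕ) (q r : TIOp) (hq : q ∈ ofRange M) (hr : r ∈ ofRange M) :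
    inner ℂ (toHilbert q) (toHilbert r) =
      ((localMatrix M q).conjTranspose * localMatrix M r).trace /
        (1 : Matrix (Fin M → Fin 2) (Fin M → Fin 2) ℂ).trace := by
  classical
  have hinj : ∀ a ∈ q.support, ∀ b ∈ r.support,
      ((fun i : Fin M => a.1 (i : ℤ)) = fun i : Fin M => b.1 (i : ℤ)) ↔ a = b := by
    intro a ha b hb
    refine ⟨fun h => ?_, fun h => by rw [h]⟩
    have ha' := (Finsupp.mem_supported ℂ q).mp hq ha
    have hb' := (Finsupp.mem_supported ℂ r).mp hr hb
    ext j
    rcases lt_or_ge j 0 with hj | hj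
    · rw [a.2.2 j hj, b.2.2 j hj]
    rcases lt_or_ge j (M : ℤ) with hjM | hjM
    · have := congrFun h ⟨j.toNat, by omega⟩
      simpa [Int.toNat_of_nonneg hj] using this
    · rw [ha' j hjM, hb' j hjM]
  have h1 : (1 : Matrix (Fin M → Fin 2) (Fin M → Fin 2) ℂ).trace = 2 ^ M := by
    simp [Matrix.trace_one]
  have h2 : ((localMatrix M q).conjTranspose * localMatrix M r).trace =
      ∑ a ∈ q.support, ∑ b ∈ r.support, if a = b then star (q a) * r b * 2 ^ M else 0 := by
    simp only [localMatrix, Matrix.conjTranspose_sum, Matrix.conjTranspose_smul, Finset.sum_mul,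
      Finset.mul_sum, Matrix.trace_sum, Matrix.smul_mul, Matrix.mul_smul, Matrix.trace_smul]
    rw [Finset.sum_comm]
    refine Finset.sum_congr rfl fun a ha => Finset.sum_congr rfl fun b hb => ?_
    rw [trace_stringMatrix M (fun i => a.1 (i : ℤ)) (fun i => b.1 (i : ℤ))]
    simp only [hinj a ha b hb]
    split_ifs
    · simp only [smul_eq_mul]
      ring
    · simp
  have h3 : inner ℂ (toHilbert q) (toHilbert r) = ∑ a ∈ q.support, star (q a) * r a := by
    rw [lp.inner_eq_tsum, tsum_eq_sum (s := q.support)]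
    · refine Finset.sum_congr rfl fun a _ => ?_
      rw [toHilbert_apply, toHilbert_apply, RCLike.inner_apply, mul_comm]
      rfl
    · intro a ha
      have : q a = 0 := by simpa using ha
      rw [toHilbert_apply, this, inner_zero_left]
  rw [h1, h2, h3, eq_div_iff (pow_ne_zero M two_ne_zero), Finset.sum_mul]
  refine Finset.sum_congr rfl fun a _ => ?_
  rw [Finset.sum_ite_eq]
  split_ifs with h
  · rfl
  · have : r a = 0 := by simpa using h
    simp [this]

end TIOp

/-! ## The local Schrieffer-Wolff transformation -/

namespace SW

open TIOp

/-- `x` is the value at `v` of the (Moore-Penrose) pseudoinverse of `L`, for the Frobenius inner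
product: `x` is orthogonal to the kernel of `L`, and `L x` is the orthogonal projection of `v` to
the range of `L`. There is at most one such `x`. -/
def IsPseudoinverseAt (L : Module.End ℂ TIOp) (v x : TIOp) : Prop :=
  (∀ k, L k = 0 → inner ℂ (toHilbert k) (toHilbert x) = 0) ∧
    ∀ y, inner ℂ (toHilbert (L y)) (toHilbert (v - L x)) = 0

open Classical in
/-- The pseudoinverse of `L` at `v`. -/
noncomputable def pseudoinverse (L : Module.End ℂ TIOp) (v : TIOp) : TIOp :=
  if h : ∃ x, IsPseudoinverseAt L v x then h.choose else 0

/-- The tuples `(k_1, …, k_p)` with `1 ≤ k_i ≤ n` and `k_1 + ⋯ + k_p = m`. -/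
def tuples (n p m : ℕ) : Finset (Fin p → ℕ) :=
  (Fintype.piFinset fun _ => Finset.Icc 1 n).filter fun k => ∑ i, k i = m

open Classical in
/-- The weight `𝔣(k_1, …, k_p)`: it is `1 / ∏_{l=1}^n card(l)!` if `k_1 ≤ ⋯ ≤ k_p`, where `card(l)`
is the number of the `k_i` that are equal to `l`, and `0` otherwise. -/
noncomputable def weight (n : ℕ) {p : ℕ} (k : Fin p → ℕ) : ℂ :=
  if Monotone k then
    (∏ l ∈ Finset.Icc 1 n, ((Finset.univ.filter fun i => k i = l).card.factorial : ℂ))⁻¹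
  else 0

/-- The nested commutator `i ad_{S_{k_p}} ⋯ i ad_{S_{k_1}}`. -/
noncomputable def nested (S : ℕ → TIOp) {p : ℕ} (k : Fin p → ℕ) : Module.End ℂ TIOp :=
  (List.ofFn fun i => iad (S (k i))).reverse.prod

/-- The potential `V_m` (`m ≥ 1`) of the transformation of order `n` with generators `S`. -/
noncomputable def potentialOf (n : ℕ) (H₀ T : TIOp) (S : ℕ → TIOp) (m : ℕ) : TIOp :=
  if m = 1 then T
  else
    (∑ p ∈ Finset.Icc 2 m, ∑ k ∈ tuples n p m, weight n k • nested S k H₀) +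
      ∑ p ∈ Finset.Icc 1 (m - 1), ∑ k ∈ tuples n p (m - 1), weight n k • nested S k T

/-- The generators `S_1, …, S_m`, found one after the other from
`i S_m = [ad_{H₀}]⁻¹ V_m` with the pseudoinverse of `ad_{H₀}`; all other values are `0`. -/
noncomputable def generatorsUpTo (n : ℕ) (H₀ T : TIOp) : ℕ → ℕ → TIOp
  | 0 => fun _ => 0
  | m + 1 => Function.update (generatorsUpTo n H₀ T m) (m + 1)
      (-Complex.I • pseudoinverse (ad H₀)
        (potentialOf n H₀ T (generatorsUpTo n H₀ T m) (m + 1)))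

/-- The generators `S_1, …, S_n` of the transformation of order `n`. -/
noncomputable def generator (n : ℕ) (H₀ T : TIOp) : ℕ → TIOp := generatorsUpTo n H₀ T n

/-- The potentials `V_m`, `m ≥ 1`, of the transformation of order `n`. -/
noncomputable def potential (n : ℕ) (H₀ T : TIOp) (m : ℕ) : TIOp :=
  potentialOf n H₀ T (generator n H₀ T) m

/-- The formal power series `exp (ε ^ k • D)` in `ε`, for `k ≥ 1`. -/
noncomputable def formalExp (k : ℕ) (D : Module.End ℂ TIOp) : PowerSeries (Module.End ℂ TIOp) :=
  PowerSeries.mk fun m =>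
    if k ∣ m then (((m / k).factorial : ℂ)⁻¹) • D ^ (m / k) else 0

/-- The superoperator `O ↦ U† O U` with `U = exp (-i ε S_1) exp (-i ε² S_2) ⋯ exp (-i εᵐ S_m)`,
as a formal power series in `ε`: it is `exp (i εᵐ ad_{S_m}) ⋯ exp (i ε ad_{S_1})`. -/
noncomputable def formalRotation (S : ℕ → TIOp) : ℕ → PowerSeries (Module.End ℂ TIOp)
  | 0 => 1
  | m + 1 => formalExp (m + 1) (iad (S (m + 1))) * formalRotation S m

/-- The coefficient of `εᵐ` in the formal expansion of `H' = U† (H₀ + ε T) U`, where `U` is the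
transformation of order `n`. -/
noncomputable def rotatedCoeff (n : ℕ) (H₀ T : TIOp) : ℕ → TIOp
  | 0 => PowerSeries.coeff 0 (formalRotation (generator n H₀ T) n) H₀
  | m + 1 => PowerSeries.coeff (m + 1) (formalRotation (generator n H₀ T) n) H₀ +
      PowerSeries.coeff m (formalRotation (generator n H₀ T) n) T

/-- The remainder `H_{>n} = ∑_{m > n} εᵐ V_m`. -/
noncomputable def remainder (n : ℕ) (H₀ T : TIOp) (ε : ℝ) : OpHilbert :=
  ∑' m : {m : ℕ // n < m}, ((ε : ℂ) ^ (m : ℕ)) • toHilbert (potential n H₀ T m)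

/-- The lower bound `ρ_n = 1 / (263 n²)` for the radius of convergence. -/
noncomputable def rho (n : ℕ) : ℝ := 1 / (263 * (n : ℝ) ^ 2)

end SW

/-!
The atomic norm of an operator, with products of suitable single-site matrices as atoms, carries the
estimate. Let `H₀ = Γ ∑_j z_j` with a traceless Hermitian unitary `2 × 2` matrix `z`
(`TIOp.exists_eq_smul_site`). A letter is a contraction which is homogeneous for the grading by the
commutator with `z` (`TIOp.IsLetter`). Letters are closed under multiplication, and a product of
letters is an eigenvector of `ad_{H₀}` whose eigenvalue is `2Γ` times an integer. Hence, for the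
norm given by the least absolute sum of the coefficients in an expansion into products of letters
(`TIOp.WordBound`),

* a commutator costs only twice the number of positions in which the two ranges overlap
  (`TIOp.WordBound.ad`), with no factor exponential in the range;
* the pseudoinverse of `ad_{H₀}` is diagonal on the atoms and has norm at most `1 / (2Γ)`
  (`TIOp.WordBound.exists_pseudoinverse`);
* on operators of range `M` the Frobenius norm is at most `M` times the atomic norm
  (`TIOp.WordBound.norm_le`), and the atomic norm is at most `10 ^ (M / 2)` times the Frobenius norm
  (`TIOp.WordBound.of_mem_ofRange`), which is used for `T` only, with `M = 2`.

The overlaps in a `p`-fold nested commutator contribute at most `(p + 1)! n ^ p` for `H₀` and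
`(p + 2)! n ^ p / 2` for `T` (`SW.wordBound_nested`). The weights `𝔣` compensate the factorial:
by the multinomial theorem the sum of `𝔣(k) ∏ y_{k_i}` over all tuples of length `p` is
`(∑ y) ^ p / p!` (`SW.sum_weight_mul_prod`). So the bounds `b_m` on `‖V_m‖ / Γ` satisfy a recursion
whose generating function stays below `1 / (10 n²)` at `1 / (230 n²)` (`SW.sum_majorant_le`). The
room between `230` and `263` absorbs the factor `m + 1` of the passage to the Frobenius norm.

The algebraic part rests on the self-adjointness of `ad_{H₀}`, seen on its matrix elements between
Pauli strings, which turns the splitting of an operator along the eigenspaces into the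
pseudoinverse, and on the expansion of the product of the formal exponentials
(`SW.coeff_formalRotation`), in which nondecreasing tuples are encoded by their multiplicities.
-/

open scoped Matrix.Norms.L2Operator

/-! ### Pauli matrices, Pauli strings and their commutators -/

namespace Pauli

instance : Fintype Pauli := ⟨{I, X, Y, Z}, fun a => by cases a <;> decide⟩

theorem sum_univ {E : Type*} [AddCommMonoid E] (g : Pauli → E) :
    ∑ a, g a = g I + g X + g Y + g Z := by
  have : (Finset.univ : Finset Pauli) = {I, X, Y, Z} := rfl
  rw [this, Finset.sum_insert (by decide), Finset.sum_insert (by decide),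
    Finset.sum_insert (by decide), Finset.sum_singleton]
  simp only [add_assoc]

/-- The coefficient of a `2 × 2` matrix at a letter of the Pauli basis. -/
noncomputable def coeff (F : Matrix (Fin 2) (Fin 2) ℂ) (a : Pauli) : ℂ := (a.mat * F).trace / 2

theorem coeff_add (F G : Matrix (Fin 2) (Fin 2) ℂ) (a : Pauli) :
    coeff (F + G) a = coeff F a + coeff G a := by
  simp [coeff, mul_add, add_div]

theorem coeff_sub (F G : Matrix (Fin 2) (Fin 2) ℂ) (a : Pauli) :
    coeff (F - G) a = coeff F a - coeff G a := by
  simp [coeff, mul_sub, sub_div]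

theorem coeff_smul (c : ℂ) (F : Matrix (Fin 2) (Fin 2) ℂ) (a : Pauli) :
    coeff (c • F) a = c * coeff F a := by
  simp [coeff, mul_div_assoc]

theorem coeff_sum {ι : Type*} (s : Finset ι) (F : ι → Matrix (Fin 2) (Fin 2) ℂ) (a : Pauli) :
    coeff (∑ i ∈ s, F i) a = ∑ i ∈ s, coeff (F i) a := by
  simp [coeff, Finset.mul_sum, Matrix.trace_sum, Finset.sum_div]

theorem coeff_mat (a b : Pauli) : coeff b.mat a = if a = b then 1 else 0 := by
  cases a <;> cases b <;> simp [coeff, mat, Matrix.trace, Fin.sum_univ_two]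

theorem mat_I : mat I = 1 := by
  ext i j; fin_cases i <;> fin_cases j <;> simp [mat]

theorem coeff_one (a : Pauli) : coeff 1 a = if a = 0 then 1 else 0 := by
  rw [← mat_I, coeff_mat]; rfl

theorem coeff_I (F : Matrix (Fin 2) (Fin 2) ℂ) : coeff F I = (F 0 0 + F 1 1) / 2 := by
  simp only [coeff, Matrix.trace, Matrix.diag, Fin.sum_univ_two, Matrix.mul_apply]
  simp [mat]

theorem coeff_X (F : Matrix (Fin 2) (Fin 2) ℂ) : coeff F X = (F 1 0 + F 0 1) / 2 := by
  simp only [coeff, Matrix.trace, Matrix.diag, Fin.sum_univ_two, Matrix.mul_apply]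
  simp [mat]

theorem coeff_Y (F : Matrix (Fin 2) (Fin 2) ℂ) :
    coeff F Y = (-(Complex.I * F 1 0) + Complex.I * F 0 1) / 2 := by
  simp only [coeff, Matrix.trace, Matrix.diag, Fin.sum_univ_two, Matrix.mul_apply]
  simp [mat]

theorem coeff_Z (F : Matrix (Fin 2) (Fin 2) ℂ) : coeff F Z = (F 0 0 + -F 1 1) / 2 := by
  simp only [coeff, Matrix.trace, Matrix.diag, Fin.sum_univ_two, Matrix.mul_apply]
  simp [mat]

theorem sum_coeff_smul_mat (F : Matrix (Fin 2) (Fin 2) ℂ) : ∑ a, coeff F a • a.mat = F := by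
  have hI : Complex.I * Complex.I = -1 := Complex.I_mul_I
  rw [sum_univ, coeff_I, coeff_X, coeff_Y, coeff_Z]
  ext i j
  fin_cases i <;> fin_cases j <;> simp [mat]
  · ring
  · linear_combination ((F 1 0 - F 0 1) / 2) * hI
  · linear_combination ((F 0 1 - F 1 0) / 2) * hI
  · ring

/-- The Pauli coefficients of a product are a twisted convolution over the Klein four-group. -/
theorem coeff_mul (F G : Matrix (Fin 2) (Fin 2) ℂ) (c : Pauli) :
    coeff (F * G) c =
      ∑ a, ∑ b, if mul a b = c then coeff F a * coeff G b * phase a b else 0 := by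
  conv_lhs => rw [← sum_coeff_smul_mat F, ← sum_coeff_smul_mat G]
  simp only [Finset.sum_mul, Finset.mul_sum, coeff_sum, smul_mul_smul_comm, mat_mul_mat,
    coeff_smul, coeff_mat]
  rw [Finset.sum_comm]
  refine Finset.sum_congr rfl fun a _ => Finset.sum_congr rfl fun b _ => ?_
  by_cases h : mul a b = c
  · simp [h]
  · simp [h, Ne.symm h]

theorem sum_norm_coeff_sq (F : Matrix (Fin 2) (Fin 2) ℂ) :
    ∑ a, ‖coeff F a‖ ^ 2 = (∑ i, ∑ j, ‖F i j‖ ^ 2) / 2 := by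
  have h : ∀ w : ℂ, ‖w‖ ^ 2 = w.re ^ 2 + w.im ^ 2 := fun w => by
    rw [← Complex.normSq_eq_norm_sq, Complex.normSq_apply]; ring
  rw [sum_univ, coeff_I, coeff_X, coeff_Y, coeff_Z]
  simp only [norm_div, div_pow, h, Fin.sum_univ_two]
  simp
  ring

/-- The normalized Hilbert–Schmidt norm is at most the operator norm. -/
theorem sum_norm_coeff_sq_le (F : Matrix (Fin 2) (Fin 2) ℂ) :
    ∑ a, ‖coeff F a‖ ^ 2 ≤ ‖F‖ ^ 2 := by
  have hcol : ∀ j : Fin 2, ∑ i, ‖F i j‖ ^ 2 ≤ ‖F‖ ^ 2 := by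
    intro j
    have h := Matrix.l2_opNorm_mulVec F (EuclideanSpace.single j (1 : ℂ))
    rw [PiLp.norm_single, norm_one, mul_one] at h
    have h2 := pow_le_pow_left₀ (norm_nonneg _) h 2
    rw [EuclideanSpace.norm_sq_eq] at h2
    simpa [Matrix.mulVec_single_one] using h2
  rw [sum_norm_coeff_sq, Finset.sum_comm, Fin.sum_univ_two]
  linarith [hcol 0, hcol 1]

theorem mul_comm (a b : Pauli) : mul a b = mul b a := by
  cases a <;> cases b <;> rfl

theorem star_phase (a b : Pauli) : star (phase a b) = phase b a := by
  cases a <;> cases b <;> simp [phase]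

theorem phase_zero_left (a : Pauli) : phase 0 a = 1 := by cases a <;> rfl

theorem phase_zero_right (a : Pauli) : phase a 0 = 1 := by cases a <;> rfl

end Pauli

namespace PauliString

/-- The Pauli strings supported in a finite set of sites. -/
noncomputable def strings (s : Finset ℤ) : Finset PauliString := s.finsupp fun _ => Finset.univ

theorem mem_strings {s : Finset ℤ} {u : PauliString} : u ∈ strings s ↔ u.support ⊆ s := by
  simp [strings, Finset.mem_finsupp_iff]

/-- Distributivity: a product of sums over letters is a sum over Pauli strings. -/
theorem prod_sum_strings (s : Finset ℤ) {R : Type*} [CommSemiring R] (g : ℤ → Pauli → R) :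
    ∏ j ∈ s, ∑ a, g j a = ∑ u ∈ strings s, ∏ j ∈ s, g j (u j) := by
  classical
  rw [Finset.prod_sum, strings, Finset.finsupp, Finset.sum_map]
  refine Finset.sum_congr (by congr; exact Subsingleton.elim _ _) fun p _ => ?_
  rw [← Finset.prod_attach s]
  refine Finset.prod_congr rfl fun x _ => ?_
  simp [Finsupp.indicator_apply]

theorem mul_apply (s t : PauliString) (j : ℤ) : mul s t j = Pauli.mul (s j) (t j) := by
  simp [mul]

theorem mul_comm (s t : PauliString) : mul s t = mul t s := by
  ext j; rw [mul_apply, mul_apply, Pauli.mul_comm]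

theorem phase_eq_prod {s t : PauliString} {G : Finset ℤ} (h : s.support ∩ t.support ⊆ G) :
    phase s t = ∏ j ∈ G, Pauli.phase (s j) (t j) := by
  refine Finset.prod_subset h fun j _ hj => ?_
  rw [Finset.mem_inter, not_and_or, Finsupp.notMem_support_iff, Finsupp.notMem_support_iff] at hj
  rcases hj with hj | hj
  · rw [hj, Pauli.phase_zero_left]
  · rw [hj, Pauli.phase_zero_right]

theorem star_phase (s t : PauliString) : star (phase s t) = phase t s := by
  rw [phase, phase, star_prod, Finset.inter_comm]
  exact Finset.prod_congr rfl fun j _ => Pauli.star_phase _ _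

theorem shift_shift (i j : ℤ) (s : PauliString) : shift i (shift j s) = shift (i + j) s := by
  ext x; simp only [shift_apply]; congr 1; ring

theorem shift_zero (s : PauliString) : shift 0 s = s := by
  ext x; simp [shift_apply]

theorem shift_injective (j : ℤ) : Function.Injective (shift j) := fun s t h => by
  have := congrArg (shift (-j)) h
  simpa [shift_shift, shift_zero] using this

theorem mem_support_shift {j x : ℤ} {s : PauliString} :
    x ∈ (shift j s).support ↔ x - j ∈ s.support := by
  simp [shift_apply]

theorem shift_mul (j : ℤ) (s t : PauliString) :
    shift j (mul s t) = mul (shift j s) (shift j t) := by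
  ext x; simp only [shift_apply, mul_apply]

theorem support_shift (j : ℤ) (s : PauliString) :
    (shift j s).support = s.support.map (Equiv.addRight j).toEmbedding := by
  ext x
  simp only [mem_support_shift, Finset.mem_map_equiv, Equiv.addRight_symm, Equiv.coe_addRight,
    sub_eq_add_neg]

theorem phase_shift (j : ℤ) (s t : PauliString) :
    phase (shift j s) (shift j t) = phase s t := by
  rw [phase, phase, support_shift, support_shift, ← Finset.map_inter, Finset.prod_map]
  simp [shift_apply]

end PauliString

namespace TIOp

open PauliString

theorem ofString_zero : ofString 0 = 0 := by simp [ofString]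

theorem ofString_coe (a : GaugedString) : ofString a.1 = Finsupp.single a 1 := by
  have h0 : (0 : ℤ) ∈ a.1.support := Finsupp.mem_support_iff.mpr a.2.1
  have hne : a.1.support.Nonempty := ⟨0, h0⟩
  have hmin : a.1.support.min' hne = 0 := by
    refine le_antisymm (Finset.min'_le _ _ h0) (Finset.le_min' _ _ _ fun x hx => ?_)
    by_contra hlt
    exact Finsupp.mem_support_iff.mp hx (a.2.2 x (not_le.mp hlt))
  rw [ofString, dif_pos hne]
  congr 1
  apply Subtype.ext
  change shift (-(a.1.support.min' hne)) a.1 = a.1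
  rw [hmin, neg_zero, shift_zero]

theorem exists_ofString_eq_single {u : PauliString} (h : u ≠ 0) :
    ∃ (j : ℤ) (a : GaugedString), j ∈ u.support ∧ (∀ x ∈ u.support, j ≤ x) ∧ shift j a.1 = u ∧
      ofString u = Finsupp.single a 1 := by
  have hne : u.support.Nonempty := Finsupp.support_nonempty_iff.mpr h
  rw [ofString, dif_pos hne]
  refine ⟨_, _, u.support.min'_mem hne, fun x hx => u.support.min'_le x hx, ?_, rfl⟩
  rw [shift_shift, add_neg_cancel, shift_zero]

/-- A Pauli string has at most one description as a translate of a gauge-fixed string. -/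
theorem gauge_unique {i j : ℤ} {a b : GaugedString} (h : shift i a.1 = shift j b.1) :
    i = j ∧ a = b := by
  have key : ∀ {i j : ℤ} {a b : GaugedString}, shift i a.1 = shift j b.1 → j ≤ i := by
    intro i j a b h
    by_contra hlt
    have h1 := DFunLike.congr_fun h i
    rw [shift_apply, shift_apply, sub_self, b.2.2 (i - j) (by omega)] at h1
    exact a.2.1 h1
  obtain rfl : i = j := le_antisymm (key h.symm) (key h)
  exact ⟨rfl, Subtype.ext (shift_injective i h)⟩

theorem ofString_shift (j : ℤ) (u : PauliString) : ofString (shift j u) = ofString u := by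
  by_cases h : u = 0
  · subst h
    have : shift j 0 = 0 := by ext x; simp [shift_apply]
    rw [this]
  have h' : shift j u ≠ 0 := fun h0 => h <| shift_injective j <| by
    rw [h0]; ext x; simp [shift_apply]
  obtain ⟨i, a, -, -, ha, ha'⟩ := exists_ofString_eq_single h
  obtain ⟨i', a', -, -, hb, hb'⟩ := exists_ofString_eq_single h'
  rw [← ha, shift_shift] at hb
  rw [ha', hb', (gauge_unique hb).2]

theorem stringComm_shift (j : ℤ) (s t : PauliString) :
    stringComm (shift j s) (shift j t) = stringComm s t := by
  rw [stringComm, phase_shift, phase_shift, ← shift_mul, ofString_shift, stringComm]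

theorem stringComm_swap (s t : PauliString) : stringComm s t = -stringComm t s := by
  rw [stringComm, stringComm, PauliString.mul_comm, ← neg_smul, neg_sub]

theorem stringComm_eq_zero {s t : PauliString} (h : Disjoint s.support t.support) :
    stringComm s t = 0 := by
  rw [stringComm, phase, phase, Finset.inter_comm t.support,
    Finset.disjoint_iff_inter_eq_empty.mp h]
  simp

/-- The commutator of two translation-invariant sums of Pauli strings; only finitely many terms
of the sum are nonzero. -/
theorem ad_ofString (u v : PauliString) :
    ad (ofString u) (ofString v) = ∑ᶠ j : ℤ, stringComm (shift j u) v := by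
  by_cases hu : u = 0
  · subst hu
    have : ∀ j, stringComm (shift j 0) v = 0 := fun j => stringComm_eq_zero <| by
      have : shift j 0 = 0 := by ext x; simp [shift_apply]
      simp [this]
    simp [ofString_zero, this]
  by_cases hv : v = 0
  · subst hv
    have : ∀ j, stringComm (shift j u) 0 = 0 := fun j => stringComm_eq_zero (by simp)
    simp [ofString_zero, this]
  obtain ⟨i, a, -, -, rfl, ha'⟩ := exists_ofString_eq_single hu
  obtain ⟨i', b, -, -, rfl, hb'⟩ := exists_ofString_eq_single hv
  rw [ha', hb']
  have h1 : ad (Finsupp.single a 1) (Finsupp.single b 1) = basisComm a b := by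
    simp [ad]
  have h2 : ∀ j, stringComm (shift j (shift i a.1)) (shift i' b.1) =
      stringComm (shift (j + (i - i')) a.1) b.1 := by
    intro j
    rw [← stringComm_shift i' (shift (j + (i - i')) a.1), shift_shift, shift_shift]
    congr 2
    ring
  simp_rw [h1, h2]
  have h3 := finsum_comp_equiv (Equiv.addRight (i - i'))
    (f := fun j => stringComm (shift j a.1) b.1)
  simp only [Equiv.coe_addRight] at h3
  rw [h3, basisComm]
  refine (finsum_eq_sum_of_support_subset _ fun j hj => ?_).symm
  by_contra hnot
  refine hj (stringComm_eq_zero (Finset.disjoint_left.mpr fun x hx hx' => hnot ?_))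
  rw [mem_support_shift] at hx
  refine Finset.mem_coe.mpr (Finset.mem_image.mpr ⟨(x, x - j), ?_, ?_⟩)
  · exact Finset.mem_product.mpr ⟨hx', hx⟩
  · simp

theorem ad_ofString_eq_sum {u v : PauliString} {J : Finset ℤ}
    (hJ : ∀ j ∉ J, Disjoint (shift j u).support v.support) :
    ad (ofString u) (ofString v) = ∑ j ∈ J, stringComm (shift j u) v := by
  rw [ad_ofString]
  refine finsum_eq_sum_of_support_subset _ fun j hj => ?_
  by_contra hnot
  exact hj (stringComm_eq_zero (hJ j hnot))

theorem ad_swap (A B : TIOp) : ad A B = -ad B A := by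
  induction A using Finsupp.induction_linear with
  | zero => simp
  | add A A' h h' => rw [map_add, map_add, LinearMap.add_apply, h, h']; abel
  | single a c =>
    induction B using Finsupp.induction_linear with
    | zero => simp
    | add B B' h h' => rw [map_add, map_add, LinearMap.add_apply, h, h']; abel
    | single b d =>
      have hs : ∀ (a : GaugedString) (c : ℂ), Finsupp.single a c = c • ofString a.1 := by
        intro a c; rw [ofString_coe]; simp
      simp only [hs, map_smul, LinearMap.smul_apply]
      rw [ad_ofString, ad_ofString, smul_comm, ← smul_neg, ← smul_neg, ← finsum_neg_distrib,
        ← finsum_comp_equiv (Equiv.neg ℤ)]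
      congr 2
      refine finsum_congr fun j => ?_
      rw [← stringComm_shift j, shift_shift, ← stringComm_swap]
      simp [shift_zero]

end TIOp

/-! ### Product operators and their Pauli expansions -/

namespace TIOp

open PauliString

section Expansion

variable {E : Type*} [AddCommGroup E] [Module ℂ E]

/-- The Pauli expansion of the product operator `⊗_{j ∈ s} f j`, where each Pauli string `u` is
replaced by `Ψ u`. -/
noncomputable def expand (s : Finset ℤ) (f : ℤ → Matrix (Fin 2) (Fin 2) ℂ)
    (Ψ : PauliString → E) : E :=
  ∑ u ∈ strings s, (∏ j ∈ s, Pauli.coeff (f j) (u j)) • Ψ u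

variable {s s' : Finset ℤ} {f g : ℤ → Matrix (Fin 2) (Fin 2) ℂ} {Ψ : PauliString → E}

theorem expand_congr (h : ∀ j ∈ s, f j = g j) : expand s f Ψ = expand s g Ψ :=
  Finset.sum_congr rfl fun u _ => by rw [Finset.prod_congr rfl fun j hj => by rw [h j hj]]

theorem expand_subset (hs : s ⊆ s') (hf : ∀ j ∈ s', j ∉ s → f j = 1) :
    expand s' f Ψ = expand s f Ψ := by
  symm
  have hsub : strings s ⊆ strings s' := fun u hu =>
    mem_strings.mpr ((mem_strings.mp hu).trans hs)
  rw [expand, expand, ← Finset.sum_subset hsub]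
  · refine Finset.sum_congr rfl fun u hu => ?_
    congr 1
    refine Finset.prod_subset hs fun j hj hjs => ?_
    have : u j = 0 := Finsupp.notMem_support_iff.mp fun h => hjs (mem_strings.mp hu h)
    rw [hf j hj hjs, Pauli.coeff_one, if_pos this]
  · intro u hu hus
    rw [mem_strings, Finset.not_subset] at hus
    obtain ⟨j, hj, hjs⟩ := hus
    have hj' := mem_strings.mp hu hj
    rw [Finset.prod_eq_zero hj', zero_smul]
    rw [hf j hj' hjs, Pauli.coeff_one, if_neg (Finsupp.mem_support_iff.mp hj)]

theorem expand_shift (i : ℤ) :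
    expand (s.map (Equiv.addRight i).toEmbedding) (fun j => f (j - i)) Ψ =
      expand s f fun u => Ψ (shift i u) := by
  symm
  refine Finset.sum_nbij' (shift i) (shift (-i)) ?_ ?_ ?_ ?_ ?_
  · intro u hu
    rw [mem_strings, support_shift]
    exact Finset.map_subset_map.mpr (mem_strings.mp hu)
  · intro u hu
    rw [mem_strings] at hu ⊢
    intro x hx
    rw [mem_support_shift] at hx
    simpa using hu hx
  · intro u _; rw [shift_shift, neg_add_cancel, shift_zero]
  · intro u _; rw [shift_shift, add_neg_cancel, shift_zero]
  · intro u _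
    simp [Finset.prod_map, shift_apply]

/-- The product of two product operators is the product operator of the sitewise products. -/
theorem expand_expand_mul :
    (expand s f fun u => expand s g fun v => phase u v • Ψ (PauliString.mul u v)) =
      expand s (fun j => f j * g j) Ψ := by
  classical
  have h1 : ∀ w : PauliString, ∏ j ∈ s, Pauli.coeff (f j * g j) (w j) =
      ∑ u ∈ strings s, ∑ v ∈ strings s, if ∀ j ∈ s, Pauli.mul (u j) (v j) = w j then
        ∏ j ∈ s, (Pauli.coeff (f j) (u j) * Pauli.coeff (g j) (v j) * Pauli.phase (u j) (v j))
        else 0 := by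
    intro w
    simp only [Pauli.coeff_mul]
    rw [prod_sum_strings]
    refine Finset.sum_congr rfl fun u _ => ?_
    rw [prod_sum_strings]
    refine Finset.sum_congr rfl fun v _ => ?_
    rw [Finset.prod_ite_zero]
  rw [expand, expand]
  simp only [h1, Finset.sum_smul]
  rw [Finset.sum_comm]
  refine Finset.sum_congr rfl fun u hu => ?_
  rw [expand, Finset.smul_sum, Finset.sum_comm]
  refine Finset.sum_congr rfl fun v hv => ?_
  rw [mem_strings] at hu hv
  have hmul : PauliString.mul u v ∈ strings s := by
    rw [mem_strings]
    intro j hj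
    by_contra hjs
    refine Finsupp.mem_support_iff.mp hj ?_
    rw [mul_apply, Finsupp.notMem_support_iff.mp fun h => hjs (hu h),
      Finsupp.notMem_support_iff.mp fun h => hjs (hv h)]
    rfl
  rw [Finset.sum_eq_single_of_mem _ hmul]
  · rw [if_pos fun j _ => (mul_apply u v j).symm, Finset.prod_mul_distrib,
      Finset.prod_mul_distrib, ← phase_eq_prod (Finset.inter_subset_left.trans hu), smul_smul,
      smul_smul, mul_assoc]
  · intro w hw hne
    rw [if_neg, zero_smul]
    intro h
    refine hne (Finsupp.ext fun j => ?_)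
    rw [mul_apply]
    by_cases hj : j ∈ s
    · exact (h j hj).symm
    · rw [Finsupp.notMem_support_iff.mp fun h => hj (hu h),
        Finsupp.notMem_support_iff.mp fun h => hj (hv h),
        Finsupp.notMem_support_iff.mp fun h => hj (mem_strings.mp hw h)]
      rfl

theorem expand_sub_right (Ψ Φ : PauliString → E) :
    (expand s f fun u => Ψ u - Φ u) = expand s f Ψ - expand s f Φ := by
  simp only [expand, smul_sub, Finset.sum_sub_distrib]

theorem expand_sum_right {ι : Type*} (J : Finset ι) (Ψ : ι → PauliString → E) :
    (expand s f fun u => ∑ j ∈ J, Ψ j u) = ∑ j ∈ J, expand s f (Ψ j) := by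
  simp only [expand, Finset.smul_sum]
  exact Finset.sum_comm

theorem expand_comm (Ψ : PauliString → PauliString → E) :
    (expand s f fun u => expand s' g fun v => Ψ u v) =
      expand s' g fun v => expand s f fun u => Ψ u v := by
  simp only [expand, Finset.smul_sum]
  rw [Finset.sum_comm]
  exact Finset.sum_congr rfl fun v _ => Finset.sum_congr rfl fun u _ => smul_comm _ _ _

theorem prod_coeff_update {j : ℤ} (hj : j ∈ s) (A : Matrix (Fin 2) (Fin 2) ℂ) (u : PauliString) :
    ∏ i ∈ s, Pauli.coeff (Function.update f j A i) (u i) =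
      Pauli.coeff A (u j) * ∏ i ∈ s.erase j, Pauli.coeff (f i) (u i) := by
  rw [← Finset.mul_prod_erase _ _ hj, Function.update_self]
  congr 1
  refine Finset.prod_congr rfl fun i hi => ?_
  rw [Function.update_of_ne (Finset.ne_of_mem_erase hi)]

theorem expand_update_add {j : ℤ} (hj : j ∈ s) (A B : Matrix (Fin 2) (Fin 2) ℂ) :
    expand s (Function.update f j (A + B)) Ψ =
      expand s (Function.update f j A) Ψ + expand s (Function.update f j B) Ψ := by
  simp only [expand, prod_coeff_update hj, Pauli.coeff_add, add_mul, add_smul,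
    Finset.sum_add_distrib]

theorem expand_update_sub {j : ℤ} (hj : j ∈ s) (A B : Matrix (Fin 2) (Fin 2) ℂ) :
    expand s (Function.update f j (A - B)) Ψ =
      expand s (Function.update f j A) Ψ - expand s (Function.update f j B) Ψ := by
  simp only [expand, prod_coeff_update hj, Pauli.coeff_sub, sub_mul, sub_smul,
    Finset.sum_sub_distrib]

theorem expand_update_smul {j : ℤ} (hj : j ∈ s) (c : ℂ) (A : Matrix (Fin 2) (Fin 2) ℂ) :
    expand s (Function.update f j (c • A)) Ψ = c • expand s (Function.update f j A) Ψ := by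
  simp only [expand, prod_coeff_update hj, Pauli.coeff_smul, Finset.smul_sum, smul_smul, mul_assoc]

end Expansion

/-- The translation-invariant operator `∑_j τ_j (⊗_{i ∈ s} f i)`. -/
noncomputable def product (s : Finset ℤ) (f : ℤ → Matrix (Fin 2) (Fin 2) ℂ) : TIOp :=
  expand s f ofString

theorem product_shift (i : ℤ) (s : Finset ℤ) (f : ℤ → Matrix (Fin 2) (Fin 2) ℂ) :
    product (s.map (Equiv.addRight i).toEmbedding) (fun j => f (j - i)) = product s f := by
  simp only [product, expand_shift, ofString_shift]

theorem map_Ico (i a b : ℤ) :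
    (Finset.Ico a b).map (Equiv.addRight i).toEmbedding = Finset.Ico (a + i) (b + i) := by
  ext x
  simp only [Finset.mem_map_equiv, Equiv.addRight_symm, Equiv.coe_addRight, Finset.mem_Ico]
  omega

theorem expand_stringComm (s : Finset ℤ) (f g : ℤ → Matrix (Fin 2) (Fin 2) ℂ) :
    (expand s f fun u => expand s g fun v => stringComm u v) =
      product s (fun j => f j * g j) - product s (fun j => g j * f j) := by
  have h1 : ∀ u v : PauliString, stringComm u v = phase u v • ofString (PauliString.mul u v) -
      phase v u • ofString (PauliString.mul v u) := by
    intro u v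
    rw [stringComm, sub_smul, PauliString.mul_comm v u]
  simp only [h1, expand_sub_right]
  rw [expand_expand_mul, expand_comm, expand_expand_mul]
  rfl

theorem ad_product_of_forall_disjoint {s s' : Finset ℤ}
    {f g : ℤ → Matrix (Fin 2) (Fin 2) ℂ} {J : Finset ℤ}
    (hJ : ∀ u ∈ strings s, ∀ v ∈ strings s', ∀ j ∉ J, Disjoint (shift j u).support v.support) :
    ad (product s f) (product s' g) = ∑ j ∈ J,
      expand (s.map (Equiv.addRight j).toEmbedding) (fun i => f (i - j)) fun u =>
        expand s' g fun v => stringComm u v := by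
  simp only [expand_shift]
  rw [← expand_sum_right]
  simp only [product, expand, map_sum, LinearMap.sum_apply, map_smul, LinearMap.smul_apply,
    Finset.smul_sum]
  rw [Finset.sum_comm]
  refine Finset.sum_congr rfl fun u hu => ?_
  rw [Finset.sum_comm]
  refine Finset.sum_congr rfl fun v hv => ?_
  rw [ad_ofString_eq_sum (hJ u hu v hv), Finset.smul_sum, Finset.smul_sum]
  exact Finset.sum_congr rfl fun j _ => smul_comm _ _ _

/-- The commutator of two products on windows of `M` and `N` sites: it is a sum over the `M + N - 1`
relative positions at which the windows meet, and each term lives on `M + N - 1` sites. -/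
theorem ad_product {M N : ℤ} (hM : 1 ≤ M) (hN : 1 ≤ N) {f g : ℤ → Matrix (Fin 2) (Fin 2) ℂ}
    (hf : ∀ j ∉ Finset.Ico 0 M, f j = 1) (hg : ∀ j ∉ Finset.Ico 0 N, g j = 1) :
    ad (product (Finset.Ico 0 M) f) (product (Finset.Ico 0 N) g) =
      ∑ j ∈ Finset.Ico (1 - M) N,
        (product (Finset.Ico (min 0 j) (min 0 j + (M + N - 1))) (fun i => f (i - j) * g i) -
          product (Finset.Ico (min 0 j) (min 0 j + (M + N - 1))) (fun i => g i * f (i - j))) := by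
  rw [ad_product_of_forall_disjoint (J := Finset.Ico (1 - M) N)]
  · refine Finset.sum_congr rfl fun j hj => ?_
    rw [Finset.mem_Ico] at hj
    rw [← expand_stringComm, map_Ico]
    have h1 : ∀ Ψ : PauliString → TIOp,
        expand (Finset.Ico (min 0 j) (min 0 j + (M + N - 1))) g Ψ = expand (Finset.Ico 0 N) g Ψ :=
      fun Ψ => expand_subset (Finset.Ico_subset_Ico (by omega) (by omega)) fun i _ hi => hg i hi
    simp only [h1]
    refine (expand_subset (Finset.Ico_subset_Ico (by omega) (by omega)) fun i _ hi => hf _ ?_).symm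
    rw [Finset.mem_Ico] at hi ⊢
    omega
  · intro u hu v hv j hj
    rw [Finset.disjoint_left]
    intro x hx hx'
    rw [mem_support_shift] at hx
    have h1 := mem_strings.mp hu hx
    have h2 := mem_strings.mp hv hx'
    rw [Finset.mem_Ico] at h1 h2 hj
    omega

/-- A single-site operator acts as a derivation on products. -/
theorem ad_product_site {N : ℤ} (hN : 1 ≤ N) (A : Matrix (Fin 2) (Fin 2) ℂ)
    {g : ℤ → Matrix (Fin 2) (Fin 2) ℂ} (hg : ∀ j ∉ Finset.Ico 0 N, g j = 1) :
    ad (product (Finset.Ico 0 1) (Function.update 1 0 A)) (product (Finset.Ico 0 N) g) =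
      ∑ j ∈ Finset.Ico 0 N,
        product (Finset.Ico 0 N) (Function.update g j (A * g j - g j * A)) := by
  rw [ad_product le_rfl hN _ hg]
  · have h0 : (1 : ℤ) - 1 = 0 := rfl
    rw [h0]
    refine Finset.sum_congr rfl fun j hj => ?_
    have hj' := Finset.mem_Ico.mp hj
    have h1 : min 0 j = 0 := by omega
    have h2 : (0 : ℤ) + (1 + N - 1) = N := by omega
    rw [h1, h2, product, product, product, expand_update_sub hj]
    refine congrArg₂ (· - ·) ?_ ?_
    · refine expand_congr fun i _ => ?_
      by_cases h : i = j
      · subst h; simp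
      · rw [Function.update_of_ne h, Function.update_of_ne (by omega)]; simp
    · refine expand_congr fun i _ => ?_
      by_cases h : i = j
      · subst h; simp
      · rw [Function.update_of_ne h, Function.update_of_ne (by omega)]; simp
  · intro j hj
    rw [Finset.mem_Ico] at hj
    rw [Function.update_of_ne (by omega)]; rfl

theorem product_mat {s : Finset ℤ} {u : PauliString} (hu : u ∈ strings s) :
    product s (fun j => (u j).mat) = ofString u := by
  rw [product, expand, Finset.sum_eq_single_of_mem u hu]
  · simp [Pauli.coeff_mat]
  · intro v hv hne
    obtain ⟨j, hj⟩ := DFunLike.ne_iff.mp hne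
    have hjs : j ∈ s := by
      by_contra hjs
      rw [mem_strings] at hu hv
      exact hj (by rw [Finsupp.notMem_support_iff.mp fun h => hjs (hu h),
        Finsupp.notMem_support_iff.mp fun h => hjs (hv h)])
    rw [Finset.prod_eq_zero hjs, zero_smul]
    rw [Pauli.coeff_mat, if_neg hj]

/-- On the window `[0, M)` the Frobenius norm of a product of contractions is at most `M`: group the
Pauli strings of the expansion by their first nontrivial site; by Parseval each group has norm at
most `1`. -/
theorem norm_product_le (M : ℕ) {f : ℤ → Matrix (Fin 2) (Fin 2) ℂ} (hf : ∀ j, ‖f j‖ ≤ 1) :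
    ‖toHilbert (product (Finset.Ico 0 (M : ℤ)) f)‖ ≤ M := by
  classical
  have key : ∀ A : Finset PauliString, A ⊆ strings (Finset.Ico 0 (M : ℤ)) → ∀ r : ℤ,
      (∀ u ∈ A, ∃ a : GaugedString, shift r a.1 = u) →
      ‖toHilbert (∑ u ∈ A, (∏ j ∈ Finset.Ico 0 (M : ℤ), Pauli.coeff (f j) (u j)) • ofString u)‖
        ≤ 1 := by
    intro A hA r hr
    rcases A.eq_empty_or_nonempty with rfl | ⟨u₀, hu₀⟩
    · simp
    have : Nonempty GaugedString := ⟨(hr u₀ hu₀).choose⟩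
    choose! G hG using hr
    have hinj : Set.InjOn G A := fun u hu v hv h => by rw [← hG u hu, ← hG v hv, h]
    set c : PauliString → ℂ := fun u => ∏ j ∈ Finset.Ico 0 (M : ℤ), Pauli.coeff (f j) (u j)
    have h1 : ∑ u ∈ A, c u • ofString u = ∑ u ∈ A, Finsupp.single (G u) (c u) := by
      refine Finset.sum_congr rfl fun u hu => ?_
      conv_lhs => rw [← hG u hu, ofString_shift, ofString_coe]
      rw [hG u hu, Finsupp.smul_single, smul_eq_mul, mul_one]
    rw [h1]
    have h2 : ∀ u ∈ A, (∑ v ∈ A, Finsupp.single (G v) (c v)) (G u) = c u := by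
      intro u hu
      rw [Finsupp.finsetSum_apply, Finset.sum_eq_single_of_mem u hu]
      · simp
      · intro v hv hne
        rw [Finsupp.single_apply, if_neg fun h => hne (hinj hv hu h)]
    have h3 : ‖toHilbert (∑ v ∈ A, Finsupp.single (G v) (c v))‖ ^ 2 = ∑ u ∈ A, ‖c u‖ ^ 2 := by
      have := lp.norm_rpow_eq_tsum (p := 2) (by norm_num)
        (toHilbert (∑ v ∈ A, Finsupp.single (G v) (c v)))
      simp only [ENNReal.toReal_ofNat, Real.rpow_ofNat, toHilbert_apply] at this
      rw [this, tsum_eq_sum (s := A.image G), Finset.sum_image hinj]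
      · exact Finset.sum_congr rfl fun u hu => by rw [h2 u hu]
      · intro a ha
        rw [Finsupp.finsetSum_apply, Finset.sum_eq_zero]
        · simp
        · intro v hv
          rw [Finsupp.single_apply, if_neg]
          rintro rfl
          exact ha (Finset.mem_image_of_mem G hv)
    have h4 : ∑ u ∈ A, ‖c u‖ ^ 2 ≤ 1 := by
      refine (Finset.sum_le_sum_of_subset_of_nonneg hA fun _ _ _ => sq_nonneg _).trans ?_
      have h5 : ∀ u, ‖c u‖ ^ 2 = ∏ j ∈ Finset.Ico 0 (M : ℤ), ‖Pauli.coeff (f j) (u j)‖ ^ 2 := by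
        intro u
        rw [norm_prod, Finset.prod_pow]
      simp only [h5]
      rw [← prod_sum_strings _ fun j a => ‖Pauli.coeff (f j) a‖ ^ 2]
      refine Finset.prod_le_one (fun j _ => Finset.sum_nonneg fun _ _ => sq_nonneg _) fun j _ => ?_
      refine (Pauli.sum_norm_coeff_sq_le (f j)).trans ?_
      exact pow_le_one₀ (norm_nonneg _) (hf j)
    nlinarith [norm_nonneg (toHilbert (∑ v ∈ A, Finsupp.single (G v) (c v)))]
  have hsplit : product (Finset.Ico 0 (M : ℤ)) f = ∑ r ∈ Finset.Ico 0 (M : ℤ),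
      ∑ u ∈ (strings (Finset.Ico 0 (M : ℤ))).filter fun u => ∃ a : GaugedString, shift r a.1 = u,
        (∏ j ∈ Finset.Ico 0 (M : ℤ), Pauli.coeff (f j) (u j)) • ofString u := by
    simp only [Finset.sum_filter]
    rw [Finset.sum_comm, product, expand]
    refine Finset.sum_congr rfl fun u hu => ?_
    by_cases h : u = 0
    · subst h
      simp [ofString_zero]
    obtain ⟨r, a, hr, -, rfl, -⟩ := exists_ofString_eq_single h
    rw [Finset.sum_eq_single_of_mem r (mem_strings.mp hu hr), if_pos ⟨a, rfl⟩]
    intro r' _ hne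
    rw [if_neg]
    rintro ⟨b, hb⟩
    exact hne (gauge_unique hb).1
  rw [hsplit, map_sum]
  refine (norm_sum_le _ _).trans ?_
  refine (Finset.sum_le_card_nsmul _ _ 1 fun r _ =>
    key _ (Finset.filter_subset _ _) r fun u hu => (Finset.mem_filter.mp hu).2).trans ?_
  simp

end TIOp

/-! ### Letters and the atomic norm -/

namespace TIOp

open PauliString

/-- A letter adapted to `z`: a contraction which is homogeneous for the grading of the `2 × 2`
matrices by the commutator with `z`. -/
def IsLetter (z F : Matrix (Fin 2) (Fin 2) ℂ) : Prop :=
  ‖F‖ ≤ 1 ∧ ∃ q : ℤ, z * F - F * z = (2 * q : ℂ) • F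

section Letter

variable {z F G : Matrix (Fin 2) (Fin 2) ℂ}

theorem isLetter_one : IsLetter z 1 :=
  ⟨by rw [CStarRing.norm_one], 0, by simp⟩

theorem isLetter_self (hz : ‖z‖ ≤ 1) : IsLetter z z := ⟨hz, 0, by simp⟩

theorem IsLetter.mul (hF : IsLetter z F) (hG : IsLetter z G) : IsLetter z (F * G) := by
  obtain ⟨hF1, q, hq⟩ := hF
  obtain ⟨hG1, r, hr⟩ := hG
  refine ⟨(norm_mul_le F G).trans (mul_le_one₀ hF1 (norm_nonneg _) hG1), q + r, ?_⟩
  have : z * (F * G) - F * G * z = (z * F - F * z) * G + F * (z * G - G * z) := by noncomm_ring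
  rw [this, hq, hr, smul_mul_assoc, mul_smul_comm, ← add_smul]
  push_cast
  ring_nf

/-- A contraction anticommuting with the involution `z` is the sum of two letters, of charges `1`
and `-1`. -/
theorem exists_isLetter_add (hz : ‖z‖ ≤ 1) (hzz : z * z = 1) (hF : ‖F‖ ≤ 1)
    (hzF : z * F = -(F * z)) : ∃ A B, IsLetter z A ∧ IsLetter z B ∧ F = A + B := by
  have hzFz : z * F * z = -F := by rw [hzF, neg_mul, mul_assoc, hzz, mul_one]
  have hzzF : z * (z * F) = F := by rw [← mul_assoc, hzz, one_mul]
  have hFz : F * z = -(z * F) := by rw [hzF, neg_neg]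
  have hn : ‖z * F‖ ≤ 1 := (norm_mul_le _ _).trans (mul_le_one₀ hz (norm_nonneg _) hF)
  refine ⟨(1 / 2 : ℂ) • (F + z * F), (1 / 2 : ℂ) • (F - z * F), ⟨?_, 1, ?_⟩, ⟨?_, -1, ?_⟩, ?_⟩
  · rw [norm_smul]
    have := norm_add_le F (z * F)
    norm_num
    linarith
  · rw [mul_smul_comm, smul_mul_assoc, ← smul_sub, mul_add, add_mul, hzzF, hzFz, hFz, smul_smul]
    push_cast
    module
  · rw [norm_smul]
    have := norm_sub_le F (z * F)
    norm_num
    linarith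
  · rw [mul_smul_comm, smul_mul_assoc, ← smul_sub, mul_sub, sub_mul, hzzF, hzFz, hFz, smul_smul]
    push_cast
    module
  · module

end Letter

/-- `WordBound z M c q` says that `q` is a linear combination of products of letters on the sites
`0, …, M - 1` whose coefficients have absolute sum at most `c`: the atomic norm of `q`, for the
atoms formed by such products, is at most `c`. -/
inductive WordBound (z : Matrix (Fin 2) (Fin 2) ℂ) (M : ℕ) : ℝ → TIOp → Prop
  | zero : WordBound z M 0 0
  | word (f : ℤ → Matrix (Fin 2) (Fin 2) ℂ) (hf : ∀ j, IsLetter z (f j))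
      (hf1 : ∀ j ∉ Finset.Ico 0 (M : ℤ), f j = 1) :
      WordBound z M 1 (product (Finset.Ico 0 (M : ℤ)) f)
  | add {c d : ℝ} {q r : TIOp} (hq : WordBound z M c q) (hr : WordBound z M d r) :
      WordBound z M (c + d) (q + r)
  | smul (a : ℂ) {c : ℝ} {q : TIOp} (hq : WordBound z M c q) : WordBound z M (‖a‖ * c) (a • q)
  | mono {c d : ℝ} {q : TIOp} (hq : WordBound z M c q) (hcd : c ≤ d) : WordBound z M d q

namespace WordBound

variable {z : Matrix (Fin 2) (Fin 2) ℂ} {M N : ℕ} {c d : ℝ} {q r : TIOp}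

theorem nonneg (h : WordBound z M c q) : 0 ≤ c := by
  induction h with
  | zero => exact le_rfl
  | word => exact zero_le_one
  | add _ _ h h' => exact add_nonneg h h'
  | smul a _ h => exact mul_nonneg (norm_nonneg a) h
  | mono _ hcd h => exact h.trans hcd

theorem sub (hq : WordBound z M c q) (hr : WordBound z M d r) :
    WordBound z M (c + d) (q - r) := by
  have h := hq.add (hr.smul (-1))
  rwa [norm_neg, norm_one, one_mul, neg_smul, one_smul, ← sub_eq_add_neg] at h

theorem sum {ι : Type*} (s : Finset ι) {c : ι → ℝ} {q : ι → TIOp}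
    (h : ∀ i ∈ s, WordBound z M (c i) (q i)) : WordBound z M (∑ i ∈ s, c i) (∑ i ∈ s, q i) := by
  classical
  induction s using Finset.induction_on with
  | empty => simpa using zero
  | insert i s hi ih =>
    rw [Finset.sum_insert hi, Finset.sum_insert hi]
    exact (h i (Finset.mem_insert_self i s)).add
      (ih fun j hj => h j (Finset.mem_insert_of_mem hj))

theorem norm_le (h : WordBound z M c q) : ‖toHilbert q‖ ≤ M * c := by
  induction h with
  | zero => simp
  | word f hf _ => simpa using norm_product_le M fun j => (hf j).1
  | add _ _ h h' =>
    rw [map_add, mul_add]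
    exact (norm_add_le _ _).trans (add_le_add h h')
  | smul a _ h =>
    rw [map_smul, norm_smul, mul_left_comm]
    exact mul_le_mul_of_nonneg_left h (norm_nonneg a)
  | mono _ hcd h => exact h.trans (mul_le_mul_of_nonneg_left hcd (Nat.cast_nonneg M))

/-- A product of letters on a translated window. -/
theorem word_window (m : ℤ) {f : ℤ → Matrix (Fin 2) (Fin 2) ℂ} (hf : ∀ j, IsLetter z (f j))
    (hf1 : ∀ j ∉ Finset.Ico m (m + M), f j = 1) :
    WordBound z M 1 (product (Finset.Ico m (m + M)) f) := by
  have h := product_shift m (Finset.Ico 0 (M : ℤ)) fun j => f (j + m)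
  rw [map_Ico] at h
  simp only [sub_add_cancel, zero_add, add_comm (M : ℤ) m] at h
  rw [h]
  refine word _ (fun j => hf _) fun j hj => hf1 _ ?_
  rw [Finset.mem_Ico] at hj ⊢
  omega

theorem ad_word_word (hM : 1 ≤ M) (hN : 1 ≤ N) {f g : ℤ → Matrix (Fin 2) (Fin 2) ℂ}
    (hf : ∀ j, IsLetter z (f j)) (hf1 : ∀ j ∉ Finset.Ico 0 (M : ℤ), f j = 1)
    (hg : ∀ j, IsLetter z (g j)) (hg1 : ∀ j ∉ Finset.Ico 0 (N : ℤ), g j = 1) :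
    WordBound z (M + N - 1) (2 * (M + N - 1))
      (ad (product (Finset.Ico 0 (M : ℤ)) f) (product (Finset.Ico 0 (N : ℤ)) g)) := by
  rw [ad_product (by omega) (by omega) hf1 hg1]
  have hK : ((M : ℤ) + N - 1) = ((M + N - 1 : ℕ) : ℤ) := by omega
  have hout : ∀ j ∈ Finset.Ico (1 - (M : ℤ)) N, ∀ i ∉ Finset.Ico (min 0 j)
      (min 0 j + ((M + N - 1 : ℕ) : ℤ)), f (i - j) = 1 ∧ g i = 1 := by
    intro j hj i hi
    rw [Finset.mem_Ico] at hj hi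
    constructor
    · refine hf1 _ ?_
      rw [Finset.mem_Ico]
      omega
    · refine hg1 _ ?_
      rw [Finset.mem_Ico]
      omega
  rw [hK]
  refine (sum (c := fun _ => 1 + 1) _ fun j hj => ?_).mono ?_
  · refine (word_window _ (fun i => (hf _).mul (hg _)) fun i hi => ?_).sub
      (word_window _ (fun i => (hg _).mul (hf _)) fun i hi => ?_)
    · rw [(hout j hj i hi).1, (hout j hj i hi).2, mul_one]
    · rw [(hout j hj i hi).1, (hout j hj i hi).2, mul_one]
  · rw [Finset.sum_const, Int.card_Ico, nsmul_eq_mul]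
    have : (((N : ℤ) - (1 - (M : ℤ))).toNat : ℝ) = (M : ℝ) + N - 1 := by
      have h1 : ((N : ℤ) - (1 - (M : ℤ))).toNat + 1 = M + N := by omega
      have h2 := congrArg (Nat.cast (R := ℝ)) h1
      push_cast at h2
      linarith
    rw [this]
    linarith

/-- The commutator is bounded for the atomic norm by twice the number of positions at which the
ranges overlap. -/
theorem ad (hM : 1 ≤ M) (hN : 1 ≤ N) (hq : WordBound z M c q) (hr : WordBound z N d r) :
    WordBound z (M + N - 1) (2 * (M + N - 1) * c * d) (TIOp.ad q r) := by
  have hMN : (0 : ℝ) ≤ 2 * (M + N - 1) := by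
    have : (1 : ℝ) ≤ M := by exact_mod_cast hM
    have : (0 : ℝ) ≤ N := Nat.cast_nonneg N
    linarith
  induction hq with
  | zero => simpa using zero
  | add _ _ h h' =>
    rw [map_add, LinearMap.add_apply]
    exact (h.add h').mono (le_of_eq (by ring))
  | smul a _ h =>
    rw [map_smul, LinearMap.smul_apply]
    exact (h.smul a).mono (le_of_eq (by ring))
  | mono _ hcd h =>
    exact h.mono (mul_le_mul_of_nonneg_right (mul_le_mul_of_nonneg_left hcd hMN) hr.nonneg)
  | word f hf hf1 =>
    induction hr with
    | zero => simpa using zero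
    | add _ _ h h' =>
      rw [map_add]
      exact (h.add h').mono (le_of_eq (by ring))
    | smul a _ h =>
      rw [map_smul]
      exact (h.smul a).mono (le_of_eq (by ring))
    | mono _ hcd h =>
      exact h.mono (mul_le_mul_of_nonneg_left hcd (by rwa [mul_one]))
    | word g hg hg1 => exact (ad_word_word hM hN hf hf1 hg hg1).mono (by linarith)

end WordBound

/-- The operator `∑_j A_j` of a single-site matrix `A`. -/
noncomputable def site (A : Matrix (Fin 2) (Fin 2) ℂ) : TIOp :=
  product (Finset.Ico 0 1) (Function.update 1 0 A)

/-- A product of letters is an eigenvector of `ad_z`; its eigenvalue is twice the total charge. -/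
theorem exists_ad_site_product {z : Matrix (Fin 2) (Fin 2) ℂ} {N : ℕ} (hN : 1 ≤ N)
    {f : ℤ → Matrix (Fin 2) (Fin 2) ℂ} (hf : ∀ j, IsLetter z (f j))
    (hf1 : ∀ j ∉ Finset.Ico 0 (N : ℤ), f j = 1) :
    ∃ q : ℤ, ad (site z) (product (Finset.Ico 0 (N : ℤ)) f) =
      (2 * q : ℂ) • product (Finset.Ico 0 (N : ℤ)) f := by
  choose q hq using fun j => (hf j).2
  refine ⟨∑ j ∈ Finset.Ico 0 (N : ℤ), q j, ?_⟩
  rw [site, ad_product_site (by omega) z hf1]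
  push_cast
  rw [Finset.mul_sum, Finset.sum_smul]
  refine Finset.sum_congr rfl fun j hj => ?_
  rw [hq, product, expand_update_smul hj, Function.update_eq_self, product]

/-- The pseudoinverse of `ad_{H₀}` is a diagonal operator on products of letters, with entries at
most `1 / (2Γ)`; the remainder `y` is the part of charge zero. -/
theorem WordBound.exists_pseudoinverse {z : Matrix (Fin 2) (Fin 2) ℂ} {N : ℕ} (hN : 1 ≤ N)
    {Γ : ℝ} (hΓ : 0 < Γ) {c : ℝ} {v : TIOp} (h : WordBound z N c v) :
    ∃ x y w, v = TIOp.ad ((Γ : ℂ) • site z) x + y ∧ TIOp.ad ((Γ : ℂ) • site z) y = 0 ∧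
      x = TIOp.ad ((Γ : ℂ) • site z) w ∧ WordBound z N (c / (2 * Γ)) x := by
  have hΓ' : (Γ : ℂ) ≠ 0 := Complex.ofReal_ne_zero.mpr hΓ.ne'
  induction h with
  | zero => exact ⟨0, 0, 0, by simp, by simp, by simp, by simpa using zero⟩
  | word f hf hf1 =>
    obtain ⟨Q, hQ⟩ := exists_ad_site_product hN hf hf1
    have hL : TIOp.ad ((Γ : ℂ) • site z) (product (Finset.Ico 0 (N : ℤ)) f) =
        (Γ * (2 * Q) : ℂ) • product (Finset.Ico 0 (N : ℤ)) f := by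
      rw [map_smul, LinearMap.smul_apply, hQ, smul_smul]
    by_cases h0 : Q = 0
    · refine ⟨0, product (Finset.Ico 0 (N : ℤ)) f, 0, by simp, ?_, by simp, ?_⟩
      · rw [hL, h0]; simp
      · exact zero.mono (by positivity)
    · have hne : (Γ * (2 * Q) : ℂ) ≠ 0 :=
        mul_ne_zero hΓ' (mul_ne_zero two_ne_zero (Int.cast_ne_zero.mpr h0))
      refine ⟨(Γ * (2 * Q) : ℂ)⁻¹ • product (Finset.Ico 0 (N : ℤ)) f, 0,
        ((Γ * (2 * Q) : ℂ)⁻¹ * (Γ * (2 * Q) : ℂ)⁻¹) • product (Finset.Ico 0 (N : ℤ)) f, ?_, by simp,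
        ?_, ((word f hf hf1).smul _).mono ?_⟩
      · rw [map_smul, hL, smul_smul, inv_mul_cancel₀ hne, one_smul, add_zero]
      · rw [map_smul, hL, smul_smul, mul_assoc, inv_mul_cancel₀ hne, mul_one]
      · have hQ1 : (1 : ℝ) ≤ |(Q : ℝ)| := by exact_mod_cast Int.one_le_abs h0
        have hn : ‖(Γ * (2 * Q) : ℂ)‖ = 2 * Γ * |(Q : ℝ)| := by
          rw [norm_mul, norm_mul, Complex.norm_real, Complex.norm_intCast, Complex.norm_two,
            Real.norm_of_nonneg hΓ.le]
          ring
        rw [norm_inv, hn, mul_one, one_div]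
        exact inv_anti₀ (by positivity) (le_mul_of_one_le_right (by positivity) hQ1)
  | add _ _ h h' =>
    obtain ⟨x, y, w, h1, h2, h3, h4⟩ := h
    obtain ⟨x', y', w', h1', h2', h3', h4'⟩ := h'
    refine ⟨x + x', y + y', w + w', ?_, ?_, ?_, (h4.add h4').mono (le_of_eq (by ring))⟩
    · rw [h1, h1', map_add]; abel
    · rw [map_add, h2, h2', add_zero]
    · rw [map_add, ← h3, ← h3']
  | smul a _ h =>
    obtain ⟨x, y, w, h1, h2, h3, h4⟩ := h
    refine ⟨a • x, a • y, a • w, ?_, ?_, ?_, (h4.smul a).mono (le_of_eq (by ring))⟩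
    · rw [h1, smul_add, LinearMap.map_smul (TIOp.ad ((Γ : ℂ) • site z))]
    · rw [map_smul, h2, smul_zero]
    · rw [map_smul, ← h3]
  | mono _ hcd h =>
    obtain ⟨x, y, w, h1, h2, h3, h4⟩ := h
    exact ⟨x, y, w, h1, h2, h3, h4.mono (by gcongr)⟩

end TIOp

/-! ### Atomic norm and Frobenius norm -/

namespace Pauli

/-- The `2 × 2` matrix with real Pauli coefficients `v`. -/
noncomputable def vecMat (v : Pauli → ℝ) : Matrix (Fin 2) (Fin 2) ℂ := ∑ a, (v a : ℂ) • a.mat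

theorem coeff_vecMat (v : Pauli → ℝ) (a : Pauli) : coeff (vecMat v) a = v a := by
  rw [vecMat, coeff_sum]
  simp only [coeff_smul, coeff_mat]
  simp

/-- The Clifford relation for traceless Hermitian `2 × 2` matrices. -/
theorem vecMat_mul_add (u v : Pauli → ℝ) (hu : u I = 0) (hv : v I = 0) :
    vecMat u * vecMat v + vecMat v * vecMat u = ((2 * ∑ a, u a * v a : ℝ) : ℂ) • 1 := by
  have hI : Complex.I * Complex.I = -1 := Complex.I_mul_I
  rw [vecMat, vecMat, sum_univ, sum_univ, sum_univ, hu, hv]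
  ext i j
  fin_cases i <;> fin_cases j <;> simp [mat] <;> ring_nf <;> simp

theorem isSelfAdjoint_vecMat (v : Pauli → ℝ) : IsSelfAdjoint (vecMat v) := by
  rw [IsSelfAdjoint, vecMat, star_sum]
  refine Finset.sum_congr rfl fun a _ => ?_
  rw [star_smul]
  congr 1
  · simp
  · ext i j
    cases a <;> fin_cases i <;> fin_cases j <;> simp [mat, Matrix.star_apply]

theorem vecMat_mul_self {v : Pauli → ℝ} (hv : v I = 0) (h1 : ∑ a, v a * v a = 1) :
    vecMat v * vecMat v = 1 := by
  have h := vecMat_mul_add v v hv hv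
  rw [h1, ← two_smul ℂ, mul_one, Complex.ofReal_ofNat] at h
  exact smul_right_injective _ (two_ne_zero (α := ℂ)) h

theorem norm_vecMat_le {v : Pauli → ℝ} (hv : v I = 0) (h1 : ∑ a, v a * v a = 1) :
    ‖vecMat v‖ ≤ 1 := by
  have h := (isSelfAdjoint_vecMat v).norm_mul_self
  rw [vecMat_mul_self hv h1, CStarRing.norm_one] at h
  nlinarith [norm_nonneg (vecMat v)]

/-- An orthonormal frame of the Pauli coefficient space which contains the identity and a given
traceless unit vector. -/
theorem exists_frame {v : Pauli → ℝ} (hv : v I = 0) (h1 : ∑ a, v a * v a = 1) :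
    ∃ R : Pauli → Pauli → ℝ, (∀ a, R I a = if a = I then 1 else 0) ∧ R Z = v ∧
      (∀ i j, ∑ a, R i a * R j a = if i = j then 1 else 0) ∧
      ∀ a b, ∑ i, R i a * R i b = if a = b then 1 else 0 := by
  let w : Pauli → EuclideanSpace ℝ Pauli := fun i =>
    if i = I then EuclideanSpace.single I 1 else WithLp.toLp 2 v
  have hinner : ∀ x y : EuclideanSpace ℝ Pauli, inner ℝ x y = ∑ a, x a * y a := by
    intro x y
    rw [PiLp.inner_apply]
    exact Finset.sum_congr rfl fun a _ => by simp [_root_.mul_comm]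
  have hw : Orthonormal ℝ (({I, Z} : Set Pauli).domRestrict w) := by
    rw [orthonormal_iff_ite]
    rintro ⟨i, hi⟩ ⟨j, hj⟩
    rw [hinner]
    change ∑ a, (w i) a * (w j) a = _
    rcases hi with rfl | rfl <;> rcases hj with rfl | rfl
    · simp [w]
    · simp [w, hv, Subtype.ext_iff]
    · simp [w, hv, Subtype.ext_iff]
    · simpa [w] using h1
  obtain ⟨b, hb⟩ := hw.exists_orthonormalBasis_extension_of_card_eq (ι := Pauli)
    (by simp)
  refine ⟨fun i a => b i a, ?_, ?_, ?_, ?_⟩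
  · intro a
    simp only [hb I (by simp)]
    simp [w]
  · ext a
    simp only [hb Z (by simp)]
    simp [w]
  · intro i j
    rw [← hinner]
    exact orthonormal_iff_ite.mp b.orthonormal i j
  · intro a c
    have h := b.sum_inner_mul_inner (EuclideanSpace.single a (1 : ℝ)) (EuclideanSpace.single c 1)
    simp only [EuclideanSpace.inner_single_left, EuclideanSpace.inner_single_right] at h
    simpa [Pi.single_apply, eq_comm] using h

theorem sum_smul_vecMat {R : Pauli → Pauli → ℝ}
    (hR : ∀ a b, ∑ i, R i a * R i b = if a = b then 1 else 0) (a : Pauli) :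
    ∑ i, (R i a : ℂ) • vecMat (R i) = a.mat := by
  simp only [vecMat, Finset.smul_sum, smul_smul]
  rw [Finset.sum_comm]
  simp only [← Finset.sum_smul]
  have : ∀ b, ∑ i, (R i a : ℂ) * R i b = if a = b then 1 else 0 := fun b => by
    rw [← Complex.ofReal_one, ← Complex.ofReal_zero, ← apply_ite, ← hR a b]
    push_cast
    rfl
  simp [this]

end Pauli

namespace TIOp

open PauliString

open Classical in
/-- The coefficient of `q` at a Pauli string, zero unless the string is gauge-fixed. -/
noncomputable def stringCoeff (q : TIOp) (u : PauliString) : ℂ :=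
  if h : u 0 ≠ 0 ∧ ∀ j < 0, u j = 0 then q ⟨u, h⟩ else 0

theorem stringCoeff_coe (q : TIOp) (a : GaugedString) : stringCoeff q a.1 = q a := by
  rw [stringCoeff, dif_pos a.2]

theorem norm_toHilbert_sq (q : TIOp) : ‖toHilbert q‖ ^ 2 = ∑ a ∈ q.support, ‖q a‖ ^ 2 := by
  have := lp.norm_rpow_eq_tsum (p := 2) (by norm_num) (toHilbert q)
  simp only [ENNReal.toReal_ofNat, Real.rpow_ofNat, toHilbert_apply] at this
  rw [this, tsum_eq_sum (s := q.support)]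
  intro a ha
  rw [Finsupp.notMem_support_iff.mp ha]
  simp

/-- Sums over the support of an operator of range `M` as sums over all Pauli strings on the
window. -/
theorem sum_support_eq {E : Type*} [AddCommMonoid E] {M : ℕ} {q : TIOp} (hq : q ∈ ofRange M)
    (F : ℂ → PauliString → E) (hF : ∀ u, F 0 u = 0) :
    ∑ a ∈ q.support, F (q a) a.1 =
      ∑ u ∈ strings (Finset.Ico 0 (M : ℤ)), F (stringCoeff q u) u := by
  classical
  have h1 : ∑ a ∈ q.support, F (q a) a.1 =
      ∑ u ∈ q.support.image Subtype.val, F (stringCoeff q u) u := by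
    rw [Finset.sum_image Subtype.val_injective.injOn]
    exact Finset.sum_congr rfl fun a _ => by rw [stringCoeff_coe]
  rw [h1]
  refine Finset.sum_subset ?_ ?_
  · intro u hu
    obtain ⟨a, ha, rfl⟩ := Finset.mem_image.mp hu
    rw [mem_strings]
    intro j hj
    have ha' := (Finsupp.mem_supported ℂ q).mp hq ha
    rw [Finset.mem_Ico]
    by_contra hcon
    refine Finsupp.mem_support_iff.mp hj ?_
    rcases lt_or_ge j 0 with h | h
    · exact a.2.2 j h
    · exact ha' j (by omega)
  · intro u _ hu
    have : stringCoeff q u = 0 := by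
      rw [stringCoeff]
      split_ifs with h
      · by_contra hne
        exact hu (Finset.mem_image.mpr ⟨⟨u, h⟩, Finsupp.mem_support_iff.mpr hne, rfl⟩)
      · rfl
    rw [this, hF]

theorem eq_sum_stringCoeff {M : ℕ} {q : TIOp} (hq : q ∈ ofRange M) :
    q = ∑ u ∈ strings (Finset.Ico 0 (M : ℤ)), stringCoeff q u • ofString u := by
  rw [← sum_support_eq hq (fun c u => c • ofString u) fun u => zero_smul _ _]
  conv_lhs => rw [← Finsupp.sum_single q, Finsupp.sum]
  refine Finset.sum_congr rfl fun a _ => ?_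
  rw [ofString_coe, Finsupp.smul_single, smul_eq_mul, mul_one]

theorem norm_sq_eq_sum_stringCoeff {M : ℕ} {q : TIOp} (hq : q ∈ ofRange M) :
    ‖toHilbert q‖ ^ 2 = ∑ u ∈ strings (Finset.Ico 0 (M : ℤ)), ‖stringCoeff q u‖ ^ 2 := by
  rw [norm_toHilbert_sq, sum_support_eq hq (fun c _ => ‖c‖ ^ 2) fun u => by simp]

theorem IsHermitian.stringCoeff_eq {q : TIOp} (hq : q.IsHermitian) (u : PauliString) :
    stringCoeff q u = ((stringCoeff q u).re : ℂ) := by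
  rw [stringCoeff]
  split_ifs with h
  · exact (Complex.conj_eq_iff_re.mp (hq _)).symm
  · simp

/-- A Hermitian single-site operator is a multiple of a traceless Hermitian unitary matrix. -/
theorem exists_eq_smul_site {Γ : ℝ} (hΓ : 0 < Γ) {H : TIOp} (hH : H ∈ ofRange 1)
    (hherm : H.IsHermitian) (hnorm : ‖toHilbert H‖ = Γ) :
    ∃ v : Pauli → ℝ, v Pauli.I = 0 ∧ ∑ a, v a * v a = 1 ∧
      H = (Γ : ℂ) • site (Pauli.vecMat v) := by
  have hW : Finset.Ico (0 : ℤ) ((1 : ℕ) : ℤ) = {0} := by ext x; simp; omega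
  have hu : ∀ u ∈ strings {0}, u = Finsupp.single 0 (u 0) := by
    intro u hu
    ext j
    by_cases hj : j = 0
    · subst hj; simp
    · rw [Finsupp.single_apply, if_neg (Ne.symm hj)]
      exact Finsupp.notMem_support_iff.mp fun h =>
        hj (Finset.mem_singleton.mp (mem_strings.mp hu h))
  let h : Pauli → ℝ := fun a => (stringCoeff H (Finsupp.single 0 a)).re
  have hc : ∀ u ∈ strings {0}, stringCoeff H u = (h (u 0) : ℂ) := by
    intro u hu'
    rw [hherm.stringCoeff_eq]
    conv_lhs => rw [hu u hu']
  refine ⟨fun a => Γ⁻¹ * h a, ?_, ?_, ?_⟩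
  · have : stringCoeff H (Finsupp.single 0 Pauli.I) = 0 := by
      rw [stringCoeff, dif_neg]
      rintro ⟨h0, -⟩
      exact h0 (by rw [Finsupp.single_eq_same]; rfl)
    simp [h, this]
  · have h1 := norm_sq_eq_sum_stringCoeff hH
    have h2 := prod_sum_strings {0} fun _ a => h a ^ 2
    simp only [Finset.prod_singleton] at h2
    rw [hnorm, hW, Finset.sum_congr rfl fun u hu' => by rw [hc u hu', Complex.norm_real,
      Real.norm_eq_abs, sq_abs], ← h2] at h1
    have h3 : ∀ a, Γ⁻¹ * h a * (Γ⁻¹ * h a) = (Γ⁻¹) ^ 2 * h a ^ 2 := fun a => by ring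
    simp only [h3]
    rw [← Finset.mul_sum, ← h1, ← mul_pow, inv_mul_cancel₀ hΓ.ne', one_pow]
  · have hW' : Finset.Ico (0 : ℤ) 1 = {0} := hW
    conv_lhs => rw [eq_sum_stringCoeff hH]
    rw [site, product, expand, hW, hW', Finset.smul_sum]
    refine Finset.sum_congr rfl fun u hu' => ?_
    rw [hc u hu', Finset.prod_singleton, Function.update_self, Pauli.coeff_vecMat, smul_smul]
    congr 1
    rw [← Complex.ofReal_mul, mul_inv_cancel_left₀ hΓ.ne']

/-- A product in which some of the factors are sums of two letters. -/
theorem WordBound.product_of_sum {z : Matrix (Fin 2) (Fin 2) ℂ} {M : ℕ} (wt : ℤ → ℝ)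
    (s : Finset ℤ) (hs : s ⊆ Finset.Ico 0 (M : ℤ)) :
    ∀ f : ℤ → Matrix (Fin 2) (Fin 2) ℂ, (∀ j ∉ s, IsLetter z (f j)) →
      (∀ j ∉ Finset.Ico 0 (M : ℤ), f j = 1) →
      (∀ j ∈ s, (IsLetter z (f j) ∧ wt j = 1) ∨
        ((∃ A B, IsLetter z A ∧ IsLetter z B ∧ f j = A + B) ∧ wt j = 2)) →
      WordBound z M (∏ j ∈ s, wt j) (product (Finset.Ico 0 (M : ℤ)) f) := by
  classical
  induction s using Finset.induction_on with
  | empty =>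
    intro f hf hf1 _
    simpa using word f (fun j => hf j (Finset.notMem_empty j)) hf1
  | insert i s hi ih =>
    intro f hf hf1 hsum
    have hsub : s ⊆ Finset.Ico 0 (M : ℤ) := (Finset.subset_insert i s).trans hs
    have hiM : i ∈ Finset.Ico 0 (M : ℤ) := hs (Finset.mem_insert_self i s)
    rw [Finset.prod_insert hi]
    rcases hsum i (Finset.mem_insert_self i s) with ⟨hfi, hwt⟩ | ⟨⟨A, B, hA, hB, hfi⟩, hwt⟩
    · rw [hwt, one_mul]
      refine ih hsub f (fun j hj => ?_) hf1 fun j hj => hsum j (Finset.mem_insert_of_mem hj)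
      by_cases h : j = i
      · rwa [h]
      · exact hf j (by simp [h, hj])
    · have key : ∀ C, IsLetter z C → WordBound z M (∏ j ∈ s, wt j)
          (product (Finset.Ico 0 (M : ℤ)) (Function.update f i C)) := by
        intro C hC
        refine ih hsub _ (fun j hj => ?_) (fun j hj => ?_) fun j hj => ?_
        · by_cases h : j = i
          · subst h; rwa [Function.update_self]
          · rw [Function.update_of_ne h]; exact hf j (by simp [h, hj])
        · rw [Function.update_of_ne (fun h => hj (by rwa [h]))]
          exact hf1 j hj
        · rw [Function.update_of_ne (fun h => hi (by rwa [← h]))]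
          exact hsum j (Finset.mem_insert_of_mem hj)
      have h := (key A hA).add (key B hB)
      rw [product, product, ← expand_update_add hiM, ← hfi, Function.update_eq_self] at h
      rw [hwt, two_mul]
      exact h

/-- The atomic norm of a Hermitian operator of range `M` is at most `10 ^ (M / 2)` times its
Frobenius norm: expand the operator in the orthonormal frame `1, z, x, y` of Pauli matrices
attached to `z`. The weights of these are `1, 1, 2, 2`, since `x` and `y` are sums of two letters,
and the Cauchy–Schwarz inequality gives the factor `1 + 1 + 4 + 4` for each site. -/
theorem WordBound.of_mem_ofRange {v : Pauli → ℝ} (hv : v Pauli.I = 0) (h1 : ∑ a, v a * v a = 1)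
    {M : ℕ} {q : TIOp} (hq : q ∈ ofRange M) (hherm : q.IsHermitian) :
    WordBound (Pauli.vecMat v) M (√(10 ^ M) * ‖toHilbert q‖) q := by
  obtain ⟨R, hRI, hRZ, hRrow, hRcol⟩ := Pauli.exists_frame hv h1
  set W := Finset.Ico 0 (M : ℤ) with hWdef
  let t : PauliString → ℝ := fun u => (stringCoeff q u).re
  let τ : PauliString → ℝ := fun w => ∑ u ∈ strings W, t u * ∏ j ∈ W, R (w j) (u j)
  let e : Pauli → Matrix (Fin 2) (Fin 2) ℂ := fun i => Pauli.vecMat (R i)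
  let wt : Pauli → ℝ := fun i => if i = Pauli.I ∨ i = Pauli.Z then 1 else 2
  have heI : e 0 = 1 := by
    have : R Pauli.I = fun a => if a = Pauli.I then 1 else 0 := funext hRI
    change Pauli.vecMat (R Pauli.I) = 1
    rw [this, Pauli.vecMat, Pauli.sum_univ]
    simp [Pauli.mat_I]
  have hprod : ∀ u ∈ strings W, ofString u =
      ∑ w ∈ strings W, ((∏ j ∈ W, R (w j) (u j) : ℝ) : ℂ) • product W fun j => e (w j) := by
    intro u hu
    rw [← product_mat hu, product, expand]
    have h2 : ∀ x : PauliString, ∏ j ∈ W, Pauli.coeff (u j).mat (x j) =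
        ∑ w ∈ strings W, ((∏ j ∈ W, R (w j) (u j) : ℝ) : ℂ) *
          ∏ j ∈ W, Pauli.coeff (e (w j)) (x j) := by
      intro x
      have h3 : ∀ j, Pauli.coeff (u j).mat (x j) =
          ∑ i, (R i (u j) : ℂ) * Pauli.coeff (e i) (x j) := by
        intro j
        rw [← Pauli.sum_smul_vecMat hRcol (u j), Pauli.coeff_sum]
        simp only [Pauli.coeff_smul, e]
      simp only [h3]
      rw [prod_sum_strings]
      refine Finset.sum_congr rfl fun w _ => ?_
      rw [Finset.prod_mul_distrib]
      push_cast
      rfl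
    simp only [h2, Finset.sum_smul, product, expand, Finset.smul_sum, smul_smul]
    exact Finset.sum_comm
  have hqsum : q = ∑ w ∈ strings W, (τ w : ℂ) • product W fun j => e (w j) := by
    conv_lhs => rw [eq_sum_stringCoeff hq]
    rw [Finset.sum_congr rfl fun u hu => by rw [hprod u hu, hherm.stringCoeff_eq]]
    simp only [Finset.smul_sum, smul_smul]
    rw [Finset.sum_comm]
    refine Finset.sum_congr rfl fun w _ => ?_
    rw [← Finset.sum_smul]
    congr 1
    simp only [τ, t]
    push_cast
    rfl
  have hparseval : ∑ w ∈ strings W, τ w ^ 2 = ‖toHilbert q‖ ^ 2 := by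
    rw [norm_sq_eq_sum_stringCoeff hq]
    have h2 : ∀ u ∈ strings W, ∀ u' ∈ strings W,
        ∑ w ∈ strings W, (∏ j ∈ W, R (w j) (u j)) * ∏ j ∈ W, R (w j) (u' j) =
          if u = u' then 1 else 0 := by
      intro u hu u' hu'
      simp only [← Finset.prod_mul_distrib]
      rw [← prod_sum_strings W fun j a => R a (u j) * R a (u' j)]
      simp only [hRcol]
      rw [Finset.prod_ite_zero, Finset.prod_const_one]
      refine if_congr ⟨fun h => Finsupp.ext fun j => ?_, fun h j _ => by rw [h]⟩ rfl rfl
      by_cases hj : j ∈ W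
      · exact h j hj
      · rw [Finsupp.notMem_support_iff.mp fun h => hj (mem_strings.mp hu h),
          Finsupp.notMem_support_iff.mp fun h => hj (mem_strings.mp hu' h)]
    have h3 : ∀ w, τ w ^ 2 = ∑ u ∈ strings W, ∑ u' ∈ strings W, t u * t u' *
        ((∏ j ∈ W, R (w j) (u j)) * ∏ j ∈ W, R (w j) (u' j)) := by
      intro w
      rw [sq, Finset.sum_mul_sum]
      exact Finset.sum_congr rfl fun u _ => Finset.sum_congr rfl fun u' _ => by ring
    simp only [h3]
    rw [Finset.sum_comm]
    refine Finset.sum_congr rfl fun u hu => ?_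
    rw [Finset.sum_comm]
    rw [Finset.sum_congr rfl fun u' hu' => by rw [← Finset.mul_sum, h2 u hu u' hu']]
    simp only [mul_ite, mul_one, mul_zero, Finset.sum_ite_eq]
    rw [if_pos hu, hherm.stringCoeff_eq, Complex.norm_real, Real.norm_eq_abs, sq_abs, sq]
  have hperp : ∀ i, i = Pauli.X ∨ i = Pauli.Y →
      ∃ A B, IsLetter (Pauli.vecMat v) A ∧ IsLetter (Pauli.vecMat v) B ∧ e i = A + B := by
    intro i hi
    have hne : i ≠ Pauli.I ∧ i ≠ Pauli.Z := by rcases hi with rfl | rfl <;> decide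
    have hi0 : R i Pauli.I = 0 := by
      have := hRrow i Pauli.I
      simpa [hRI, hne.1] using this
    have hi1 : ∑ a, R i a * R i a = 1 := by simpa using hRrow i i
    refine exists_isLetter_add (Pauli.norm_vecMat_le hv h1) (Pauli.vecMat_mul_self hv h1)
      (Pauli.norm_vecMat_le hi0 hi1) ?_
    have h2 := Pauli.vecMat_mul_add v (R i) hv hi0
    have h3 := hRrow Pauli.Z i
    rw [if_neg (Ne.symm hne.2), hRZ] at h3
    rw [h3, mul_zero, Complex.ofReal_zero, zero_smul] at h2
    exact eq_neg_of_add_eq_zero_left h2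
  have hletter : ∀ i, (IsLetter (Pauli.vecMat v) (e i) ∧ wt i = 1) ∨
      ((∃ A B, IsLetter (Pauli.vecMat v) A ∧ IsLetter (Pauli.vecMat v) B ∧ e i = A + B) ∧
        wt i = 2) := by
    intro i
    cases i with
    | I => exact Or.inl ⟨by rw [show e Pauli.I = 1 from heI]; exact isLetter_one, by simp [wt]⟩
    | X => exact Or.inr ⟨hperp _ (Or.inl rfl), by simp [wt]⟩
    | Y => exact Or.inr ⟨hperp _ (Or.inr rfl), by simp [wt]⟩
    | Z =>
      refine Or.inl ⟨?_, by simp [wt]⟩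
      simp only [e, hRZ]
      exact isLetter_self (Pauli.norm_vecMat_le hv h1)
  have hword : ∀ w ∈ strings W, WordBound (Pauli.vecMat v) M (∏ j ∈ W, wt (w j))
      (product W fun j => e (w j)) := by
    intro w hw
    have hout : ∀ j ∉ W, e (w j) = 1 := fun j hj => by
      rw [Finsupp.notMem_support_iff.mp fun h => hj (mem_strings.mp hw h), heI]
    exact product_of_sum (fun j => wt (w j)) W subset_rfl _
      (fun j hj => by rw [hout j hj]; exact isLetter_one) hout fun j _ => hletter _
  have hsum := sum (strings W) fun w hw => (hword w hw).smul (τ w : ℂ)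
  rw [← hqsum] at hsum
  refine hsum.mono ?_
  have hwt : ∑ w ∈ strings W, (∏ j ∈ W, wt (w j)) ^ 2 = 10 ^ M := by
    simp only [← Finset.prod_pow]
    rw [← prod_sum_strings W fun _ a => wt a ^ 2, Finset.prod_const]
    have : ∑ a, wt a ^ 2 = 10 := by
      rw [Pauli.sum_univ]; simp [wt]; norm_num
    rw [this, hWdef, Int.card_Ico]
    simp
  have hcs := Real.sum_mul_le_sqrt_mul_sqrt (strings W) (fun w => ∏ j ∈ W, wt (w j)) fun w => |τ w|
  simp only [sq_abs] at hcs
  rw [hwt, hparseval, Real.sqrt_sq (norm_nonneg _)] at hcs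
  refine le_trans (le_of_eq ?_) hcs
  exact Finset.sum_congr rfl fun w _ => by
    rw [Complex.norm_real, Real.norm_eq_abs, _root_.mul_comm]

end TIOp

/-! ### Weights, multiplicities and the formal rotation -/

namespace SW

open TIOp

/-- The nondecreasing list in which `1, …, n` occur with the multiplicities `c 1, …, c n`. -/
def blocks (c : ℕ → ℕ) : ℕ → List ℕ
  | 0 => []
  | n + 1 => blocks c n ++ List.replicate (c (n + 1)) (n + 1)

theorem mem_blocks {c : ℕ → ℕ} {n a : ℕ} (h : a ∈ blocks c n) : a ∈ Finset.Icc 1 n := by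
  induction n with
  | zero => simp [blocks] at h
  | succ n ih =>
    rw [blocks, List.mem_append] at h
    rcases h with h | h
    · have := Finset.mem_Icc.mp (ih h)
      exact Finset.mem_Icc.mpr ⟨this.1, by omega⟩
    · rw [List.eq_of_mem_replicate h]
      simp

theorem pairwise_blocks (c : ℕ → ℕ) (n : ℕ) : (blocks c n).Pairwise (· ≤ ·) := by
  induction n with
  | zero => exact List.Pairwise.nil
  | succ n ih =>
    rw [blocks, List.pairwise_append]
    refine ⟨ih, List.pairwise_replicate.mpr (Or.inr le_rfl), fun a ha b hb => ?_⟩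
    rw [List.eq_of_mem_replicate hb]
    have := Finset.mem_Icc.mp (mem_blocks ha)
    omega

theorem count_blocks (c : ℕ → ℕ) (n a : ℕ) :
    (blocks c n).count a = if a ∈ Finset.Icc 1 n then c a else 0 := by
  induction n with
  | zero =>
    have : a ∉ Finset.Icc 1 0 := by simp
    simp [blocks]
  | succ n ih =>
    rw [blocks, List.count_append, ih, List.count_replicate]
    simp only [Finset.mem_Icc, beq_iff_eq]
    by_cases h : n + 1 = a
    · subst h; simp
    · rw [if_neg h, add_zero]
      exact if_congr (by omega) rfl rfl

theorem length_blocks (c : ℕ → ℕ) (n : ℕ) : (blocks c n).length = ∑ l ∈ Finset.Icc 1 n, c l := by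
  induction n with
  | zero => rfl
  | succ n ih => rw [blocks, List.length_append, ih, List.length_replicate,
      Finset.sum_Icc_succ_top (by omega)]

theorem sum_blocks (c : ℕ → ℕ) (n : ℕ) : (blocks c n).sum = ∑ l ∈ Finset.Icc 1 n, l * c l := by
  induction n with
  | zero => rfl
  | succ n ih => rw [blocks, List.sum_append, ih, List.sum_replicate,
      Finset.sum_Icc_succ_top (by omega), smul_eq_mul, mul_comm (c _)]

theorem prod_map_blocks {R : Type*} [CommMonoid R] (y : ℕ → R) (c : ℕ → ℕ) (n : ℕ) :
    ((blocks c n).map y).prod = ∏ l ∈ Finset.Icc 1 n, y l ^ c l := by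
  induction n with
  | zero => rfl
  | succ n ih => rw [blocks, List.map_append, List.prod_append, ih, List.map_replicate,
      List.prod_replicate, Finset.prod_Icc_succ_top (by omega)]

theorem count_ofFn {p : ℕ} (k : Fin p → ℕ) (a : ℕ) :
    (List.ofFn k).count a = (Finset.univ.filter fun i => k i = a).card := by
  rw [List.ofFn_eq_map, List.count, List.countP_map, List.countP_eq_length_filter]
  rfl

theorem eq_blocks_of_pairwise {n : ℕ} {L : List ℕ} (hL : L.Pairwise (· ≤ ·))
    (h : ∀ a ∈ L, a ∈ Finset.Icc 1 n) {c : ℕ → ℕ} (hc : ∀ a ∈ Finset.Icc 1 n, c a = L.count a) :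
    blocks c n = L := by
  refine List.Perm.eq_of_pairwise' (pairwise_blocks c n) hL (List.perm_iff_count.mpr fun a => ?_)
  rw [count_blocks]
  split_ifs with ha
  · exact hc a ha
  · exact (List.count_eq_zero_of_not_mem fun h' => ha (h a h')).symm

open Classical in
/-- Nondecreasing tuples of numbers in `[1, n]` correspond to their multiplicities. -/
theorem sum_monotone_eq {E : Type*} [AddCommMonoid E] (n p : ℕ) (F : List ℕ → E) :
    ∑ k ∈ (Fintype.piFinset fun _ : Fin p => Finset.Icc 1 n).filter (fun k => Monotone k),
      F (List.ofFn k) = ∑ c ∈ Finset.piAntidiag (Finset.Icc 1 n) p, F (blocks c n) := by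
  have key : ∀ k ∈ (Fintype.piFinset fun _ : Fin p => Finset.Icc 1 n).filter
      (fun k => Monotone k),
      blocks (fun a => (List.ofFn k).count a) n = List.ofFn k := by
    intro k hk
    rw [Finset.mem_filter, Fintype.mem_piFinset] at hk
    refine eq_blocks_of_pairwise (List.pairwise_ofFn.mpr fun i j hij => hk.2 hij.le) ?_
      fun a _ => rfl
    intro a ha
    obtain ⟨i, rfl⟩ := List.mem_ofFn.mp ha
    exact hk.1 i
  have key2 : ∀ c ∈ Finset.piAntidiag (Finset.Icc 1 n) p,
      (List.ofFn fun i : Fin p => (blocks c n).getD i 0) = blocks c n := by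
    intro c hc
    rw [Finset.mem_piAntidiag] at hc
    have hlen : (blocks c n).length = p := by rw [length_blocks, hc.1]
    refine List.ext_getElem (by simp [hlen]) fun i h1 h2 => ?_
    rw [List.getElem_ofFn, List.getD_eq_getElem _ _ h2]
  refine Finset.sum_nbij' (fun k a => (List.ofFn k).count a)
    (fun c i => (blocks c n).getD i 0) ?_ ?_ ?_ ?_ ?_
  · intro k hk
    rw [Finset.mem_piAntidiag]
    constructor
    · rw [← length_blocks, key k hk, List.length_ofFn]
    · intro a ha
      obtain ⟨i, rfl⟩ := List.mem_ofFn.mp (List.count_pos_iff.mp (Nat.pos_of_ne_zero ha))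
      exact Fintype.mem_piFinset.mp (Finset.mem_filter.mp hk).1 i
  · intro c hc
    have h := key2 c hc
    rw [Finset.mem_filter, Fintype.mem_piFinset]
    constructor
    · intro i
      have h2 : (blocks c n).getD i 0 ∈ List.ofFn fun i : Fin p => (blocks c n).getD i 0 :=
        List.mem_ofFn.mpr ⟨i, rfl⟩
      rw [h] at h2
      exact mem_blocks h2
    · have h2 := pairwise_blocks c n
      rw [← h, List.pairwise_ofFn] at h2
      intro i j hij
      rcases hij.eq_or_lt with rfl | hlt
      · exact le_rfl
      · exact h2 hlt
  · intro k hk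
    have h := key k hk
    ext i
    simp only [h]
    rw [List.getD_eq_getElem _ _ (by simp), List.getElem_ofFn]
  · intro c hc
    have h := key2 c hc
    ext a
    simp only [h]
    rw [count_blocks]
    split_ifs with ha
    · rfl
    · by_contra hne
      exact ha ((Finset.mem_piAntidiag.mp hc).2 a (Ne.symm hne))
  · intro k hk
    rw [key k hk]

/-- The weight of a nondecreasing list with given multiplicities. -/
theorem weight_eq {n p : ℕ} {k : Fin p → ℕ} (hk : Monotone k) :
    weight n k = (∏ l ∈ Finset.Icc 1 n, (((List.ofFn k).count l).factorial : ℂ))⁻¹ := by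
  rw [weight, if_pos hk]
  simp only [count_ofFn]

theorem weight_eq_norm (n : ℕ) {p : ℕ} (k : Fin p → ℕ) : weight n k = (‖weight n k‖ : ℂ) := by
  rw [weight]
  split_ifs
  · simp
  · simp

/-- A weighted sum over tuples is a sum over multiplicities. -/
theorem sum_weight_smul {E : Type*} [AddCommGroup E] [Module ℂ E] (n p : ℕ) (F : List ℕ → E) :
    ∑ k ∈ Fintype.piFinset fun _ : Fin p => Finset.Icc 1 n, weight n k • F (List.ofFn k) =
      ∑ c ∈ Finset.piAntidiag (Finset.Icc 1 n) p,
        (∏ l ∈ Finset.Icc 1 n, ((c l).factorial : ℂ))⁻¹ • F (blocks c n) := by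
  classical
  have h := sum_monotone_eq n p fun L =>
    (∏ l ∈ Finset.Icc 1 n, ((L.count l).factorial : ℂ))⁻¹ • F L
  rw [Finset.sum_filter] at h
  rw [Finset.sum_congr rfl fun k _ => ?_, h]
  · refine Finset.sum_congr rfl fun c _ => ?_
    congr 2
    exact Finset.prod_congr rfl fun l hl => by rw [count_blocks, if_pos hl]
  · split_ifs with hk
    · rw [weight_eq hk]
    · rw [weight, if_neg hk, zero_smul]

/-- The weights turn sums over tuples into an exponential series. -/
theorem sum_weight_mul_prod (n p : ℕ) (y : ℕ → ℝ) :
    ∑ k ∈ Fintype.piFinset fun _ : Fin p => Finset.Icc 1 n, ‖weight n k‖ * ∏ i, y (k i) =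
      (∑ l ∈ Finset.Icc 1 n, y l) ^ p / p.factorial := by
  have h := sum_weight_smul n p fun L => ((L.map fun a => (y a : ℂ)).prod)
  have h1 : ∑ k ∈ Fintype.piFinset fun _ : Fin p => Finset.Icc 1 n,
      weight n k • ((List.ofFn k).map fun a => (y a : ℂ)).prod =
      ((∑ k ∈ Fintype.piFinset fun _ : Fin p => Finset.Icc 1 n,
        ‖weight n k‖ * ∏ i, y (k i) : ℝ) : ℂ) := by
    push_cast
    refine Finset.sum_congr rfl fun k _ => ?_
    rw [List.map_ofFn, List.prod_ofFn, smul_eq_mul, ← weight_eq_norm]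
    rfl
  rw [h1] at h
  rw [eq_div_iff (by positivity), Finset.sum_pow_eq_sum_piAntidiag]
  apply Complex.ofReal_injective
  rw [Complex.ofReal_mul, h, Finset.sum_mul]
  push_cast
  refine Finset.sum_congr rfl fun c hc => ?_
  have hm := Nat.multinomial_spec (Finset.Icc 1 n) c
  rw [(Finset.mem_piAntidiag.mp hc).1] at hm
  have hne : (∏ l ∈ Finset.Icc 1 n, ((c l).factorial : ℂ)) ≠ 0 :=
    Finset.prod_ne_zero_iff.mpr fun l _ => Nat.cast_ne_zero.mpr (Nat.factorial_ne_zero _)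
  rw [← hm, prod_map_blocks, smul_eq_mul]
  push_cast
  field_simp

/-- The coefficient of `εᵐ` in the product of the exponentials `exp (εˡ D_l)`, by the distribution
of the degree `m` among the factors. -/
theorem coeff_formalRotation_eq_sum_piAntidiag (S : ℕ → TIOp) (n m : ℕ) :
    PowerSeries.coeff m (formalRotation S n) =
      ∑ d ∈ Finset.piAntidiag (Finset.Icc 1 n) m,
        if ∀ l ∈ Finset.Icc 1 n, l ∣ d l then
          (∏ l ∈ Finset.Icc 1 n, ((d l / l).factorial : ℂ))⁻¹ •
            ((blocks (fun l => d l / l) n).map fun a => iad (S a)).reverse.prod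
        else 0 := by
  induction n generalizing m with
  | zero =>
    rw [formalRotation, PowerSeries.coeff_one]
    have h0 : Finset.Icc 1 0 = (∅ : Finset ℕ) := rfl
    rw [h0]
    by_cases hm : m = 0
    · subst hm
      simp [blocks]
    · rw [if_neg hm, Finset.piAntidiag_empty_of_ne_zero hm, Finset.sum_empty]
  | succ n ih =>
    have hnot : n + 1 ∉ Finset.Icc 1 n := by simp
    have hins : Finset.Icc 1 (n + 1) = Finset.cons (n + 1) (Finset.Icc 1 n) hnot := by
      rw [Finset.cons_eq_insert]
      ext a; simp only [Finset.mem_Icc, Finset.mem_insert]; omega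
    have hblocks : ∀ (c c' : ℕ → ℕ) (N : ℕ), (∀ l ∈ Finset.Icc 1 N, c l = c' l) →
        blocks c N = blocks c' N := by
      intro c c' N h
      induction N with
      | zero => rfl
      | succ N ihN =>
        rw [blocks, blocks, h (N + 1) (by simp), ihN fun l hl => h l ?_]
        have := Finset.mem_Icc.mp hl
        exact Finset.mem_Icc.mpr ⟨this.1, by omega⟩
    rw [formalRotation, PowerSeries.coeff_mul, hins, Finset.piAntidiag_cons,
      Finset.sum_disjiUnion]
    refine Finset.sum_congr rfl fun x _ => ?_
    rw [ih, Finset.mul_sum, Finset.sum_map]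
    refine Finset.sum_congr rfl fun d hd => ?_
    have hd0 : d (n + 1) = 0 := by
      by_contra hne
      exact hnot ((Finset.mem_piAntidiag.mp hd).2 _ hne)
    simp only [addRightEmbedding_apply]
    set d' : ℕ → ℕ := d + fun t => if t = n + 1 then x.1 else 0 with hd'
    have h1 : d' (n + 1) = x.1 := by simp [hd', hd0]
    have h2 : ∀ l ∈ Finset.Icc 1 n, d' l = d l := by
      intro l hl
      have : l ≠ n + 1 := fun h => hnot (h ▸ hl)
      simp [hd', this]
    rw [Finset.prod_cons, blocks, h1, hblocks (fun l => d' l / l) (fun l => d l / l) n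
      fun l hl => by rw [h2 l hl]]
    have h4 : ∏ l ∈ Finset.Icc 1 n, ((d' l / l).factorial : ℂ) =
        ∏ l ∈ Finset.Icc 1 n, ((d l / l).factorial : ℂ) :=
      Finset.prod_congr rfl fun l hl => by rw [h2 l hl]
    rw [h4]
    have h3 : (∀ l ∈ Finset.cons (n + 1) (Finset.Icc 1 n) hnot, l ∣ d' l) ↔
        (n + 1 ∣ x.1 ∧ ∀ l ∈ Finset.Icc 1 n, l ∣ d l) := by
      rw [Finset.forall_mem_cons, h1]
      exact and_congr_right fun _ => forall₂_congr fun l hl => by rw [h2 l hl]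
    rw [if_congr h3 rfl rfl, formalExp, PowerSeries.coeff_mk]
    by_cases ha : n + 1 ∣ x.1
    · by_cases hb : ∀ l ∈ Finset.Icc 1 n, l ∣ d l
      · rw [if_pos ha, if_pos hb, if_pos ⟨ha, hb⟩, smul_mul_smul_comm, mul_inv]
        simp
      · rw [if_neg hb, mul_zero, if_neg (fun h => hb h.2)]
    · rw [if_neg ha, zero_mul, if_neg (fun h => ha h.1)]

/-- The expansion of the formal rotation over tuples. -/
theorem coeff_formalRotation (S : ℕ → TIOp) (n m : ℕ) :
    PowerSeries.coeff m (formalRotation S n) =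
      ∑ p ∈ Finset.range (m + 1), ∑ k ∈ tuples n p m, weight n k • nested S k := by
  classical
  have h1 : ∀ p, ∑ k ∈ tuples n p m, weight n k • nested S k =
      ∑ c ∈ (Finset.piAntidiag (Finset.Icc 1 n) p).filter
        (fun c => ∑ l ∈ Finset.Icc 1 n, l * c l = m),
        (∏ l ∈ Finset.Icc 1 n, ((c l).factorial : ℂ))⁻¹ •
          ((blocks c n).map fun a => iad (S a)).reverse.prod := by
    intro p
    have h := sum_weight_smul n p fun L =>
      if L.sum = m then (L.map fun a => iad (S a)).reverse.prod else 0
    simp only [sum_blocks, smul_ite, smul_zero] at h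
    rw [Finset.sum_filter, ← h, tuples, Finset.sum_filter]
    refine Finset.sum_congr rfl fun k _ => ?_
    rw [List.sum_ofFn, nested, List.map_ofFn]
    rfl
  simp only [h1]
  rw [coeff_formalRotation_eq_sum_piAntidiag, ← Finset.sum_filter, Finset.sum_sigma']
  refine Finset.sum_bij' (fun d _ => ⟨∑ l ∈ Finset.Icc 1 n, d l / l, fun l => d l / l⟩)
    (fun x _ => fun l => l * x.2 l) ?_ ?_ ?_ ?_ ?_
  · intro d hd
    rw [Finset.mem_filter, Finset.mem_piAntidiag] at hd
    obtain ⟨⟨hsum, hsupp⟩, hdiv⟩ := hd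
    rw [Finset.mem_sigma, Finset.mem_range, Finset.mem_filter, Finset.mem_piAntidiag]
    refine ⟨?_, ⟨rfl, fun l hl => hsupp l fun h => hl (by simp [h])⟩, ?_⟩
    · rw [← hsum]
      have hle : ∑ l ∈ Finset.Icc 1 n, d l / l ≤ ∑ l ∈ Finset.Icc 1 n, d l :=
        Finset.sum_le_sum fun l _ => Nat.div_le_self (d l) l
      exact Nat.lt_succ_of_le hle
    · rw [← hsum]
      exact Finset.sum_congr rfl fun l hl => Nat.mul_div_cancel' (hdiv l hl)
  · rintro ⟨p, c⟩ hx
    rw [Finset.mem_sigma, Finset.mem_range, Finset.mem_filter, Finset.mem_piAntidiag] at hx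
    obtain ⟨-, ⟨-, hsupp⟩, hsum⟩ := hx
    simp only at hsupp hsum
    rw [Finset.mem_filter, Finset.mem_piAntidiag]
    exact ⟨⟨hsum, fun l hl => hsupp l fun h => hl (by simp [h])⟩, fun l _ => dvd_mul_right _ _⟩
  · intro d hd
    rw [Finset.mem_filter, Finset.mem_piAntidiag] at hd
    obtain ⟨⟨hsum, hsupp⟩, hdiv⟩ := hd
    ext l
    by_cases hl : l ∈ Finset.Icc 1 n
    · exact Nat.mul_div_cancel' (hdiv l hl)
    · have : d l = 0 := by
        by_contra hne
        exact hl (hsupp l hne)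
      simp [this]
  · rintro ⟨p, c⟩ hx
    rw [Finset.mem_sigma, Finset.mem_range, Finset.mem_filter, Finset.mem_piAntidiag] at hx
    obtain ⟨-, ⟨hp, hsupp⟩, hsum⟩ := hx
    simp only at hp hsupp hsum
    have hc : (fun l => l * c l / l) = c := by
      ext l
      by_cases hl : l ∈ Finset.Icc 1 n
      · exact Nat.mul_div_cancel_left _ (Finset.mem_Icc.mp hl).1
      · have : c l = 0 := by
          by_contra hne
          exact hl (hsupp l hne)
        simp [this]
    have hp' : ∑ l ∈ Finset.Icc 1 n, l * c l / l = p := by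
      rw [← hp]
      exact Finset.sum_congr rfl fun l _ => congrFun hc l
    simp only [hp', hc]
  · intro d _
    rfl

theorem sum_tuples_zero (S : ℕ → TIOp) (n m : ℕ) :
    ∑ k ∈ tuples n 0 m, weight n k • nested S k = if m = 0 then 1 else 0 := by
  by_cases hm : m = 0
  · subst hm
    have : tuples n 0 0 = {Fin.elim0} := by
      ext k
      simp [tuples, eq_iff_true_of_subsingleton]
    have hmono : Monotone (Fin.elim0 : Fin 0 → ℕ) := fun i => i.elim0
    rw [this, Finset.sum_singleton, if_pos rfl, nested, weight, if_pos hmono]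
    simp
  · rw [if_neg hm, Finset.sum_eq_zero]
    intro k hk
    rw [tuples, Finset.mem_filter] at hk
    exact absurd (by simpa using hk.2.symm) hm

theorem sum_tuples_one (S : ℕ → TIOp) (n m : ℕ) :
    ∑ k ∈ tuples n 1 m, weight n k • nested S k =
      if m ∈ Finset.Icc 1 n then iad (S m) else 0 := by
  have hmem : ∀ k, k ∈ tuples n 1 m ↔ k = (fun _ => m) ∧ m ∈ Finset.Icc 1 n := by
    intro k
    rw [tuples, Finset.mem_filter, Fintype.mem_piFinset, Fin.sum_univ_one, Fin.forall_fin_one]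
    constructor
    · rintro ⟨h1, rfl⟩
      exact ⟨funext fun i => by rw [Subsingleton.elim i 0], h1⟩
    · rintro ⟨rfl, h⟩
      exact ⟨h, rfl⟩
  split_ifs with hm
  · have : tuples n 1 m = {fun _ => m} := by
      ext k
      rw [hmem, Finset.mem_singleton]
      exact and_iff_left hm
    rw [this, Finset.sum_singleton, weight, if_pos monotone_const, nested]
    have hone : ∏ l ∈ Finset.Icc 1 n,
        ((Finset.univ.filter fun _ : Fin 1 => m = l).card.factorial : ℂ) = 1 := by
      refine Finset.prod_eq_one fun l _ => ?_
      by_cases h : m = l <;> simp [h]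
    rw [hone]
    simp
  · rw [Finset.sum_eq_zero]
    intro k hk
    exact absurd ((hmem k).mp hk).2 hm

/-- The coefficients of the formal expansion of `H'`, for arbitrary generators. -/
theorem coeff_formalRotation_apply (n : ℕ) (H₀ T : TIOp) (S : ℕ → TIOp) {m : ℕ} (hm : 1 ≤ m) :
    PowerSeries.coeff m (formalRotation S n) H₀ +
        PowerSeries.coeff (m - 1) (formalRotation S n) T =
      (if m ∈ Finset.Icc 1 n then iad (S m) H₀ else 0) + potentialOf n H₀ T S m := by
  have hH : PowerSeries.coeff m (formalRotation S n) H₀ =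
      (if m ∈ Finset.Icc 1 n then iad (S m) H₀ else 0) +
        ∑ p ∈ Finset.Icc 2 m, ∑ k ∈ tuples n p m, weight n k • nested S k H₀ := by
    have hIcc : Finset.Icc 2 m = Finset.Ico 2 (m + 1) := by ext; simp
    rw [coeff_formalRotation, Finset.range_eq_Ico, Finset.sum_eq_sum_Ico_succ_bot (by omega),
      Finset.sum_eq_sum_Ico_succ_bot (by omega), sum_tuples_zero, if_neg (by omega), zero_add,
      zero_add, sum_tuples_one, hIcc, LinearMap.add_apply]
    congr 1
    · split_ifs <;> rfl
    · simp only [LinearMap.sum_apply, LinearMap.smul_apply]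
  rw [hH, add_assoc]
  congr 1
  rw [potentialOf]
  split_ifs with h1
  · subst h1
    rw [coeff_formalRotation]
    simp [sum_tuples_zero]
  · congr 1
    have hIcc : Finset.Icc 1 (m - 1) = Finset.Ico 1 (m - 1 + 1) := by ext; simp
    rw [coeff_formalRotation, Finset.range_eq_Ico, Finset.sum_eq_sum_Ico_succ_bot (by omega),
      sum_tuples_zero, if_neg (by omega), zero_add, zero_add, hIcc]
    simp only [LinearMap.sum_apply, LinearMap.smul_apply]

end SW

/-! ### Self-adjointness, adjoints and the pseudoinverse -/

namespace Pauli

theorem isSelfAdjoint_mat (a : Pauli) : IsSelfAdjoint a.mat := by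
  rw [IsSelfAdjoint]
  ext i j
  cases a <;> fin_cases i <;> fin_cases j <;> simp [mat, Matrix.star_apply]

theorem coeff_commutator_zero (z A : Matrix (Fin 2) (Fin 2) ℂ) : coeff (z * A - A * z) 0 = 0 := by
  have h : (0 : Pauli).mat = 1 := mat_I
  rw [coeff, h, one_mul, Matrix.trace_sub, Matrix.trace_mul_comm, sub_self, zero_div]

/-- The commutator with a Hermitian matrix is a Hermitian superoperator on `2 × 2` matrices. -/
theorem star_coeff_commutator {z : Matrix (Fin 2) (Fin 2) ℂ} (hz : IsSelfAdjoint z)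
    (a b : Pauli) :
    star (coeff (z * a.mat - a.mat * z) b) = coeff (z * b.mat - b.mat * z) a := by
  have hz' : z.conjTranspose = z := hz
  have ha : a.mat.conjTranspose = a.mat := isSelfAdjoint_mat a
  have hb : b.mat.conjTranspose = b.mat := isSelfAdjoint_mat b
  rw [coeff, coeff, star_div₀, ← Matrix.trace_conjTranspose, Matrix.conjTranspose_mul,
    Matrix.conjTranspose_sub, Matrix.conjTranspose_mul, Matrix.conjTranspose_mul, hz', ha, hb,
    sub_mul, mul_sub, Matrix.trace_sub, Matrix.trace_sub, mul_assoc z,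
    Matrix.trace_mul_comm z (a.mat * b.mat)]
  simp [mul_assoc]

end Pauli

namespace TIOp

open PauliString

theorem inner_toHilbert (q r : TIOp) :
    inner ℂ (toHilbert q) (toHilbert r) = ∑ a ∈ q.support, star (q a) * r a := by
  rw [lp.inner_eq_tsum, tsum_eq_sum (s := q.support)]
  · refine Finset.sum_congr rfl fun a _ => ?_
    rw [toHilbert_apply, toHilbert_apply, RCLike.inner_apply, _root_.mul_comm]
    rfl
  · intro a ha
    rw [toHilbert_apply, Finsupp.notMem_support_iff.mp ha, inner_zero_left]

theorem toHilbert_injective : Function.Injective toHilbert := fun q r h => by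
  ext a
  rw [← toHilbert_apply, h, toHilbert_apply]

theorem inner_toHilbert_single (a : GaugedString) (q : TIOp) :
    inner ℂ (toHilbert (Finsupp.single a 1)) (toHilbert q) = q a := by
  rw [inner_toHilbert, Finsupp.support_single _ one_ne_zero]
  simp

open Classical in
/-- The matrix elements of `ad_z` between Pauli strings: the strings differ in at most one site,
where the matrix element is that of the commutator with `z`. -/
theorem ad_site_single_apply (z : Matrix (Fin 2) (Fin 2) ℂ) (a b : GaugedString) {N : ℕ}
    (hN : 1 ≤ N) (hb : b.1 ∈ strings (Finset.Ico 0 (N : ℤ))) :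
    ad (site z) (Finsupp.single b 1) a = ∑ j ∈ Finset.Ico 0 (N : ℤ),
      if ∀ i ≠ j, b.1 i = a.1 i then
        Pauli.coeff (z * (b.1 j).mat - (b.1 j).mat * z) (a.1 j) else 0 := by
  have hout : ∀ j ∉ Finset.Ico 0 (N : ℤ), (b.1 j).mat = 1 := by
    intro j hj
    rw [Finsupp.notMem_support_iff.mp fun h => hj (mem_strings.mp hb h)]
    exact Pauli.mat_I
  rw [← ofString_coe, ← product_mat hb, site, ad_product_site (by omega) z hout,
    Finsupp.finsetSum_apply]
  refine Finset.sum_congr rfl fun j hj => ?_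
  set C := z * (b.1 j).mat - (b.1 j).mat * z with hC
  have h1 : product (Finset.Ico 0 (N : ℤ)) (Function.update (fun i => (b.1 i).mat) j C) =
      ∑ c, Pauli.coeff C c • ofString (b.1.update j c) := by
    have h2 : ∀ c : Pauli, product (Finset.Ico 0 (N : ℤ))
        (Function.update (fun i => (b.1 i).mat) j c.mat) = ofString (b.1.update j c) := by
      intro c
      have hmem : b.1.update j c ∈ strings (Finset.Ico 0 (N : ℤ)) := by
        rw [mem_strings] at hb ⊢
        intro i hi
        by_cases h : i = j
        · rwa [h]
        · rw [Finsupp.mem_support_iff, Finsupp.coe_update, Function.update_of_ne h] at hi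
          exact hb (Finsupp.mem_support_iff.mpr hi)
      rw [← product_mat hmem]
      congr 1
      ext1 i
      rw [Finsupp.coe_update]
      by_cases h : i = j
      · subst h; simp
      · simp [h]
    simp only [← h2]
    conv_lhs => rw [← Pauli.sum_coeff_smul_mat C]
    simp only [Pauli.sum_univ, product, expand_update_add hj, expand_update_smul hj]
  rw [h1, Finsupp.finsetSum_apply]
  have h3 : ∀ c : Pauli, (Pauli.coeff C c • ofString (b.1.update j c)) a =
      if b.1.update j c = a.1 then Pauli.coeff C c else 0 := by
    intro c
    by_cases hc : c = 0
    · have : Pauli.coeff C c = 0 := by rw [hc, hC, Pauli.coeff_commutator_zero]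
      simp [this]
    · have hg : b.1.update j c 0 ≠ 0 ∧ ∀ i < 0, b.1.update j c i = 0 := by
        rw [Finsupp.coe_update]
        constructor
        · by_cases h : (0 : ℤ) = j
          · subst h; simpa using hc
          · rw [Function.update_of_ne h]; exact b.2.1
        · intro i hi
          have := (Finset.mem_Ico.mp hj).1
          rw [Function.update_of_ne (by omega)]
          exact b.2.2 i hi
      have := ofString_coe ⟨b.1.update j c, hg⟩
      simp only at this
      rw [this, Finsupp.smul_apply, Finsupp.single_apply, smul_eq_mul, mul_ite, mul_one, mul_zero]
      exact if_congr Subtype.ext_iff rfl rfl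
  simp only [h3]
  have h4 : ∀ c, b.1.update j c = a.1 ↔ c = a.1 j ∧ ∀ i ≠ j, b.1 i = a.1 i := by
    intro c
    rw [DFunLike.ext_iff, Finsupp.coe_update]
    constructor
    · intro h
      refine ⟨by simpa using h j, fun i hi => ?_⟩
      have := h i
      rwa [Function.update_of_ne hi] at this
    · rintro ⟨rfl, h⟩ i
      by_cases hi : i = j
      · subst hi; simp
      · rw [Function.update_of_ne hi]; exact h i hi
  simp only [h4]
  split_ifs with h
  · rw [Finset.sum_eq_single (a.1 j)]
    · rw [if_pos ⟨rfl, h⟩]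
    · intro c _ hc
      rw [if_neg fun h' => hc h'.1]
    · intro h'
      exact absurd (Finset.mem_univ _) h'
  · exact Finset.sum_eq_zero fun c _ => if_neg fun h' => h h'.2

/-- A gauge-fixed string is supported in every sufficiently long window `[0, N)`. -/
theorem exists_mem_strings (a : GaugedString) :
    ∃ N : ℕ, 1 ≤ N ∧ ∀ N' ≥ N, a.1 ∈ strings (Finset.Ico 0 (N' : ℤ)) := by
  refine ⟨(∑ j ∈ a.1.support, j.toNat) + 1, by omega, fun N' hN' => mem_strings.mpr fun j hj => ?_⟩
  have h1 := Finset.single_le_sum (f := fun j : ℤ => j.toNat) (fun _ _ => Nat.zero_le _) hj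
  have h2 : 0 ≤ j := by
    by_contra hlt
    exact Finsupp.mem_support_iff.mp hj (a.2.2 j (not_le.mp hlt))
  rw [Finset.mem_Ico]
  omega

theorem inner_ad_site {z : Matrix (Fin 2) (Fin 2) ℂ} (hz : IsSelfAdjoint z) (q r : TIOp) :
    inner ℂ (toHilbert (ad (site z) q)) (toHilbert r) =
      inner ℂ (toHilbert q) (toHilbert (ad (site z) r)) := by
  classical
  induction q using Finsupp.induction_linear with
  | zero => simp
  | add q q' h h' => rw [map_add, map_add, map_add, inner_add_left, inner_add_left, h, h']
  | single a c =>
    induction r using Finsupp.induction_linear with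
    | zero => simp
    | add r r' h h' => rw [map_add, map_add, map_add, inner_add_right, inner_add_right, h, h']
    | single b d =>
      have hs : ∀ (a : GaugedString) (c : ℂ), Finsupp.single a c = c • Finsupp.single a 1 := by
        intro a c; simp
      rw [hs a c, hs b d]
      simp only [map_smul, inner_smul_left, inner_smul_right]
      congr 2
      rw [← inner_conj_symm, inner_toHilbert_single, inner_toHilbert_single]
      obtain ⟨N₁, hN₁, ha⟩ := exists_mem_strings a
      obtain ⟨N₂, -, hb⟩ := exists_mem_strings b
      rw [ad_site_single_apply z b a (N := N₁ + N₂) (by omega) (ha _ (by omega)),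
        ad_site_single_apply z a b (N := N₁ + N₂) (by omega) (hb _ (by omega)), map_sum]
      refine Finset.sum_congr rfl fun j _ => ?_
      rw [apply_ite (starRingEnd ℂ), map_zero]
      refine if_congr (forall₂_congr fun i _ => eq_comm) ?_ rfl
      exact Pauli.star_coeff_commutator hz _ _

/-- Complex conjugation of the coefficients in the Pauli basis, that is, the adjoint. -/
noncomputable def conj : TIOp →+ TIOp := Finsupp.mapRange.addMonoidHom (starAddEquiv : ℂ ≃+ ℂ)

theorem conj_apply (q : TIOp) (a : GaugedString) : conj q a = star (q a) := rfl

theorem isHermitian_iff {q : TIOp} : q.IsHermitian ↔ conj q = q := by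
  rw [Finsupp.ext_iff]; rfl

theorem conj_smul (c : ℂ) (q : TIOp) : conj (c • q) = star c • conj q := by
  ext a; simp [conj_apply]

theorem conj_ofString (u : PauliString) : conj (ofString u) = ofString u := by
  by_cases h : u = 0
  · rw [h, ofString_zero, map_zero]
  · obtain ⟨-, a, -, -, -, ha⟩ := exists_ofString_eq_single h
    ext b
    rw [conj_apply, ha, Finsupp.single_apply]
    split_ifs <;> simp

theorem conj_basisComm (a b : GaugedString) : conj (basisComm a b) = -basisComm a b := by
  rw [basisComm, map_sum, ← Finset.sum_neg_distrib]
  refine Finset.sum_congr rfl fun j _ => ?_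
  rw [stringComm, conj_smul, conj_ofString, star_sub, PauliString.star_phase,
    PauliString.star_phase, ← neg_smul, neg_sub]

/-- The adjoint of a commutator. -/
theorem conj_ad (A B : TIOp) : conj (ad A B) = -ad (conj A) (conj B) := by
  have hs : ∀ (a : GaugedString) (c : ℂ), conj (Finsupp.single a c) = Finsupp.single a (star c) :=
    fun a c => Finsupp.mapRange_single (hf := star_zero ℂ)
  induction A using Finsupp.induction_linear with
  | zero => simp
  | add A A' h h' =>
    rw [map_add, LinearMap.add_apply, map_add, h, h', map_add, map_add, LinearMap.add_apply,
      neg_add]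
  | single a c =>
    induction B using Finsupp.induction_linear with
    | zero => simp
    | add B B' h h' => rw [map_add, map_add, h, h', map_add, map_add, neg_add]
    | single b d =>
      have h : ∀ c d : ℂ, ad (Finsupp.single a c) (Finsupp.single b d) =
          c • d • basisComm a b := by
        intro c d; simp [ad]
      rw [hs, hs, h, h, conj_smul, conj_smul, conj_basisComm, smul_neg, smul_neg]

theorem IsHermitian.iad {A B : TIOp} (hA : A.IsHermitian) (hB : B.IsHermitian) :
    (iad A B).IsHermitian := by
  rw [isHermitian_iff] at *
  rw [TIOp.iad, LinearMap.smul_apply, conj_smul, conj_ad, hA, hB]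
  simp

end TIOp

namespace SW

open TIOp

/-- A decomposition of `v` along the range and the kernel of `L` which exhibits `x` as the value of
the pseudoinverse of a normal operator `L` at `v`. -/
def IsSplitting (L : Module.End ℂ TIOp) (v x : TIOp) : Prop :=
  ∃ y w, v = L x + y ∧ L y = 0 ∧ x = L w

theorem IsPseudoinverseAt.unique {L : Module.End ℂ TIOp} {v x x' : TIOp}
    (h : IsPseudoinverseAt L v x) (h' : IsPseudoinverseAt L v x') : x = x' := by
  have h1 : L (x - x') = 0 := by
    apply toHilbert_injective
    rw [map_zero, ← inner_self_eq_zero (𝕜 := ℂ)]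
    have h2 : toHilbert (L (x - x')) = toHilbert (v - L x') - toHilbert (v - L x) := by
      rw [← map_sub, map_sub L]; congr 1; abel
    have h3 : inner ℂ (toHilbert (L (x - x')))
        (toHilbert (v - L x') - toHilbert (v - L x)) = 0 := by
      rw [inner_sub_right, h'.2, h.2, sub_zero]
    rwa [← h2] at h3
  have h3 : toHilbert (x - x') = 0 := by
    rw [← inner_self_eq_zero (𝕜 := ℂ)]
    have h4 := h.1 _ h1
    have h5 := h'.1 _ h1
    conv_lhs => rw [map_sub, inner_sub_right, ← map_sub, h4, h5, sub_zero]
  exact sub_eq_zero.mp (toHilbert_injective (by rw [h3, map_zero]))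

theorem pseudoinverse_eq {L : Module.End ℂ TIOp} {v x : TIOp} (h : IsPseudoinverseAt L v x) :
    pseudoinverse L v = x := by
  have hex : ∃ x, IsPseudoinverseAt L v x := ⟨x, h⟩
  rw [pseudoinverse, dif_pos hex]
  exact hex.choose_spec.unique h

section Field

variable {z : Matrix (Fin 2) (Fin 2) ℂ} (Γ : ℝ)

theorem inner_ad_smul_site (hz : IsSelfAdjoint z) (q r : TIOp) :
    inner ℂ (toHilbert (ad ((Γ : ℂ) • site z) q)) (toHilbert r) =
      inner ℂ (toHilbert q) (toHilbert (ad ((Γ : ℂ) • site z) r)) := by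
  simp only [map_smul, LinearMap.smul_apply, inner_smul_left, inner_smul_right, inner_ad_site hz,
    Complex.conj_ofReal]

theorem IsSplitting.isPseudoinverseAt (hz : IsSelfAdjoint z) {v x : TIOp}
    (h : IsSplitting (ad ((Γ : ℂ) • site z)) v x) :
    IsPseudoinverseAt (ad ((Γ : ℂ) • site z)) v x := by
  obtain ⟨y, w, rfl, hy, rfl⟩ := h
  refine ⟨fun k hk => ?_, fun u => ?_⟩
  · rw [← inner_ad_smul_site Γ hz, hk, map_zero, inner_zero_left]
  · rw [add_sub_cancel_left, inner_ad_smul_site Γ hz, hy, map_zero, inner_zero_right]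

/-- For Hermitian `v` the operator `x` is antihermitian: `-x†` is another value of the pseudoinverse
at `v`. -/
theorem IsSplitting.isHermitian (hz : IsSelfAdjoint z) {v x : TIOp}
    (hH : ((Γ : ℂ) • site z).IsHermitian) (hv : v.IsHermitian)
    (h : IsSplitting (ad ((Γ : ℂ) • site z)) v x) : (-Complex.I • x).IsHermitian := by
  have h' := h.isPseudoinverseAt Γ hz
  obtain ⟨y, w, h1, h2, h3⟩ := h
  rw [isHermitian_iff] at *
  have hconj : IsSplitting (ad ((Γ : ℂ) • site z)) v (-conj x) := by
    refine ⟨conj y, conj w, ?_, ?_, ?_⟩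
    · rw [map_neg, ← hv]
      conv_lhs => rw [h1]
      rw [map_add, conj_ad, hH]
    · have := conj_ad ((Γ : ℂ) • site z) y
      rw [h2, map_zero, hH] at this
      exact neg_eq_zero.mp this.symm
    · conv_lhs => rw [h3]
      rw [conj_ad, hH, neg_neg]
  have := (hconj.isPseudoinverseAt Γ hz).unique h'
  rw [conj_smul]
  rw [neg_eq_iff_eq_neg.mp this]
  simp

end Field

theorem isHermitian_sum {ι : Type*} (s : Finset ι) {q : ι → TIOp}
    (h : ∀ i ∈ s, (q i).IsHermitian) : (∑ i ∈ s, q i).IsHermitian := by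
  rw [isHermitian_iff, map_sum]
  exact Finset.sum_congr rfl fun i hi => isHermitian_iff.mp (h i hi)

theorem isHermitian_weight_smul (n : ℕ) {p : ℕ} (k : Fin p → ℕ) {q : TIOp} (h : q.IsHermitian) :
    (weight n k • q).IsHermitian := by
  rw [isHermitian_iff] at *
  rw [conj_smul, h, weight_eq_norm]
  simp

theorem nested_eq (S : ℕ → TIOp) {p : ℕ} (k : Fin p → ℕ) :
    nested S k = ((List.ofFn k).map fun a => iad (S a)).reverse.prod := by
  rw [nested, List.map_ofFn]; rfl

theorem isHermitian_nested {S : ℕ → TIOp} (hS : ∀ a, (S a).IsHermitian) {p : ℕ} (k : Fin p → ℕ)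
    {q : TIOp} (h : q.IsHermitian) : (nested S k q).IsHermitian := by
  rw [nested_eq]
  induction List.ofFn k using List.reverseRecOn with
  | nil => simpa using h
  | append_singleton L a ih =>
    rw [List.map_append, List.reverse_append]
    simpa using (hS a).iad ih

theorem isHermitian_potentialOf (n : ℕ) {H₀ T : TIOp} {S : ℕ → TIOp} (hH : H₀.IsHermitian)
    (hT : T.IsHermitian) (hS : ∀ a, (S a).IsHermitian) (m : ℕ) :
    (potentialOf n H₀ T S m).IsHermitian := by
  rw [potentialOf]
  split_ifs with h
  · exact hT
  · have h1 := isHermitian_sum (Finset.Icc 2 m) fun p _ => isHermitian_sum (tuples n p m)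
      fun k _ => isHermitian_weight_smul n k (isHermitian_nested hS k hH)
    have h2 := isHermitian_sum (Finset.Icc 1 (m - 1)) fun p _ =>
      isHermitian_sum (tuples n p (m - 1))
        fun k _ => isHermitian_weight_smul n k (isHermitian_nested hS k hT)
    rw [isHermitian_iff] at *
    rw [map_add, h1, h2]

theorem exists_mem_ofRange (q : TIOp) : ∃ M : ℕ, 1 ≤ M ∧ q ∈ ofRange M := by
  choose N hN1 hN using exists_mem_strings
  refine ⟨(∑ a ∈ q.support, N a) + 1, by omega, (Finsupp.mem_supported ℂ q).mpr fun a ha j hj => ?_⟩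
  have h1 := Finset.single_le_sum (f := N) (fun _ _ => Nat.zero_le _) ha
  have h2 := hN a ((∑ a ∈ q.support, N a) + 1) (by omega)
  refine Finsupp.notMem_support_iff.mp fun h => ?_
  have := Finset.mem_Ico.mp (PauliString.mem_strings.mp h2 h)
  omega

/-- The entries `k_i` of the tuples in the definition of the potential `V_m` are smaller than
`m`. -/
theorem lt_of_mem_tuples {n p m : ℕ} {k : Fin p → ℕ} (hk : k ∈ tuples n p m) (hp : 2 ≤ p)
    (i : Fin p) : k i < m := by
  rw [tuples, Finset.mem_filter, Fintype.mem_piFinset] at hk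
  have : Nontrivial (Fin p) := Fin.nontrivial_iff_two_le.mpr hp
  obtain ⟨j, hj⟩ := exists_ne i
  have h1 := Finset.add_le_sum (f := k) (s := Finset.univ) (fun _ _ => Nat.zero_le _)
    (Finset.mem_univ i) (Finset.mem_univ j) hj.symm
  have h2 := (Finset.mem_Icc.mp (hk.1 j)).1
  omega

theorem le_of_mem_tuples {n p m : ℕ} {k : Fin p → ℕ} (hk : k ∈ tuples n p m) (i : Fin p) :
    k i ≤ m := by
  rw [tuples, Finset.mem_filter] at hk
  rw [← hk.2]
  exact Finset.single_le_sum (f := k) (fun _ _ => Nat.zero_le _) (Finset.mem_univ i)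

theorem nested_congr {S S' : ℕ → TIOp} {p : ℕ} {k : Fin p → ℕ} (h : ∀ i, S (k i) = S' (k i)) :
    nested S k = nested S' k := by
  simp only [nested, h]

theorem potentialOf_congr (n : ℕ) (H₀ T : TIOp) {S S' : ℕ → TIOp} {m : ℕ}
    (h : ∀ a < m, S a = S' a) : potentialOf n H₀ T S m = potentialOf n H₀ T S' m := by
  rw [potentialOf, potentialOf]
  split_ifs with hm
  · rfl
  · refine congrArg₂ (· + ·) ?_ ?_
    · refine Finset.sum_congr rfl fun p hp => Finset.sum_congr rfl fun k hk => ?_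
      rw [nested_congr fun i => h _ (lt_of_mem_tuples hk (Finset.mem_Icc.mp hp).1 i)]
    · refine Finset.sum_congr rfl fun p hp => Finset.sum_congr rfl fun k hk => ?_
      rw [nested_congr fun i => h _ ?_]
      have h1 := le_of_mem_tuples hk i
      have h2 := Finset.mem_Icc.mp hp
      omega

theorem generatorsUpTo_of_le (n : ℕ) (H₀ T : TIOp) {a N : ℕ} (h : a ≤ N) :
    generatorsUpTo n H₀ T N a = generatorsUpTo n H₀ T a a := by
  induction N, h using Nat.le_induction with
  | base => rfl
  | succ N hN ih => rw [generatorsUpTo, Function.update_of_ne (by omega), ih]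

/-- The defining equation of the generators. -/
theorem generator_eq (n : ℕ) (H₀ T : TIOp) {m : ℕ} (hm : 1 ≤ m) (hmn : m ≤ n) :
    generator n H₀ T m = -Complex.I • pseudoinverse (ad H₀) (potential n H₀ T m) := by
  obtain ⟨m, rfl⟩ : ∃ l, m = l + 1 := ⟨m - 1, by omega⟩
  have h : potentialOf n H₀ T (generatorsUpTo n H₀ T m) (m + 1) = potential n H₀ T (m + 1) := by
    refine potentialOf_congr n H₀ T fun a ha => ?_
    rw [generator, generatorsUpTo_of_le n H₀ T (show a ≤ m by omega),
      generatorsUpTo_of_le n H₀ T (show a ≤ n by omega)]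
  rw [generator, generatorsUpTo_of_le n H₀ T hmn, generatorsUpTo, Function.update_self, h]

end SW

/-! ### Bounds on the potentials in the atomic norm -/

namespace SW

open TIOp

/-- A nested commutator with generators of range `a + 1`, `a ≤ n`, and atomic norm `b a / 2`,
applied to an operator of range `r`. The `i`-th commutator involves at most `(i + r) n`
overlapping positions. -/
theorem wordBound_nested {z : Matrix (Fin 2) (Fin 2) ℂ} {n : ℕ} (hn : 1 ≤ n) {b : ℕ → ℝ}
    {S : ℕ → TIOp} {r : ℕ} (hr : 1 ≤ r) {c : ℝ} {O : TIOp} (hO : WordBound z r c O) (L : List ℕ)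
    (hL : ∀ a ∈ L, a ∈ Finset.Icc 1 n ∧ WordBound z (a + 1) (b a / 2) (S a)) :
    WordBound z (r + L.sum)
      (c * (((L.length + r).factorial : ℝ) / r.factorial * (n : ℝ) ^ L.length * (L.map b).prod))
      ((L.map fun a => iad (S a)).reverse.prod O) := by
  induction L using List.reverseRecOn with
  | nil =>
    have : (r.factorial : ℝ) ≠ 0 := Nat.cast_ne_zero.mpr (Nat.factorial_ne_zero r)
    simpa [this] using hO
  | append_singleton L a ih =>
    have ih := ih fun a' ha' => hL a' (List.mem_append_left _ ha')
    obtain ⟨ha, hSa⟩ := hL a (by simp)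
    have hsum : L.sum ≤ L.length * n := by
      have := List.sum_le_card_nsmul L n fun a' ha' =>
        (Finset.mem_Icc.mp (hL a' (List.mem_append_left _ ha')).1).2
      simpa using this
    have han := (Finset.mem_Icc.mp ha).2
    have hprod : ((L ++ [a]).map fun a => iad (S a)).reverse.prod O =
        Complex.I • TIOp.ad (S a) ((L.map fun a => iad (S a)).reverse.prod O) := by
      rw [List.map_append, List.reverse_append]
      simp [iad]
    have h := (WordBound.ad (by omega) (by omega) hSa ih).smul Complex.I
    rw [hprod]
    have hrange : a + 1 + (r + L.sum) - 1 = r + (L ++ [a]).sum := by simp; omega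
    rw [hrange] at h
    refine h.mono ?_
    set C := c * (((L.length + r).factorial : ℝ) / r.factorial * (n : ℝ) ^ L.length *
      (L.map b).prod) with hC
    have hC0 : 0 ≤ C := ih.nonneg
    have hb0 : 0 ≤ b a := by have := hSa.nonneg; linarith
    -- the number of overlaps is at most `a + r + L.sum`, and all entries are at most `n`
    have hover : ((a + r + L.sum : ℕ) : ℝ) ≤ ((L.length + 1 + r) * n : ℕ) := by
      refine Nat.cast_le.mpr ?_
      nlinarith
    have hfac : ((L.length + 1 + r).factorial : ℝ) =
        (L.length + 1 + r : ℕ) * (L.length + r).factorial := by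
      have : L.length + 1 + r = L.length + r + 1 := by omega
      rw [this, Nat.factorial_succ]
      push_cast
      ring
    calc ‖Complex.I‖ * (2 * (((a + 1 : ℕ) : ℝ) + ((r + L.sum : ℕ) : ℝ) - 1) * (b a / 2) * C)
        = ((a + r + L.sum : ℕ) : ℝ) * (b a * C) := by
          rw [Complex.norm_I]; push_cast; ring
      _ ≤ ((L.length + 1 + r) * n : ℕ) * (b a * C) :=
          mul_le_mul_of_nonneg_right hover (mul_nonneg hb0 hC0)
      _ = _ := by
          rw [List.length_append, List.length_singleton, List.map_append, List.prod_append, hfac,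
            hC]
          simp only [List.map_cons, List.map_nil, List.prod_singleton]
          push_cast
          ring

/-- The bound on the potential `V_m / Γ` in the atomic norm which results from bounds `b a / 2` on
the generators. -/
noncomputable def potentialBound (n : ℕ) (b : ℕ → ℝ) (m : ℕ) : ℝ :=
  ∑ p ∈ Finset.Icc 2 m, ∑ k ∈ tuples n p m,
      ‖weight n k‖ * ((p + 1).factorial * (n : ℝ) ^ p * ∏ i, b (k i)) +
    10 * ∑ p ∈ Finset.range m, ∑ k ∈ tuples n p (m - 1),
      ‖weight n k‖ * ((p + 2).factorial / 2 * (n : ℝ) ^ p * ∏ i, b (k i))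

theorem wordBound_weight_nested {z : Matrix (Fin 2) (Fin 2) ℂ} {n : ℕ} (hn : 1 ≤ n) {b : ℕ → ℝ}
    {S : ℕ → TIOp} {r : ℕ} (hr : 1 ≤ r) {c : ℝ} {O : TIOp} (hO : WordBound z r c O) {p m : ℕ}
    {k : Fin p → ℕ} (hk : k ∈ tuples n p m)
    (hS : ∀ i, WordBound z (k i + 1) (b (k i) / 2) (S (k i))) :
    WordBound z (r + m)
      (c * (‖weight n k‖ * (((p + r).factorial : ℝ) / r.factorial * (n : ℝ) ^ p * ∏ i, b (k i))))
      (weight n k • nested S k O) := by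
  have hk' := hk
  rw [tuples, Finset.mem_filter, Fintype.mem_piFinset] at hk'
  have h := wordBound_nested hn hr hO (List.ofFn k) (b := b) (S := S) (by
    intro a ha
    obtain ⟨i, rfl⟩ := List.mem_ofFn.mp ha
    exact ⟨hk'.1 i, hS i⟩)
  rw [List.sum_ofFn, hk'.2, List.length_ofFn, List.map_ofFn, List.prod_ofFn, ← nested_eq] at h
  refine (h.smul (weight n k)).mono (le_of_eq ?_)
  simp only [Function.comp_apply]
  ring

theorem wordBound_potentialOf {z : Matrix (Fin 2) (Fin 2) ℂ} {n : ℕ} (hn : 1 ≤ n) {b : ℕ → ℝ}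
    {S : ℕ → TIOp} {Γ : ℝ} {H₀ T : TIOp} (hH : WordBound z 1 Γ H₀)
    (hT : WordBound z 2 (10 * Γ) T) {m : ℕ} (hm : 1 ≤ m)
    (hS : ∀ a ∈ Finset.Icc 1 n, a < m → WordBound z (a + 1) (b a / 2) (S a)) :
    WordBound z (m + 1) (Γ * potentialBound n b m) (potentialOf n H₀ T S m) := by
  rw [potentialOf]
  split_ifs with h1
  · subst h1
    refine hT.mono (le_of_eq ?_)
    have : tuples n 0 0 = {Fin.elim0} := by
      ext k
      simp [tuples, eq_iff_true_of_subsingleton]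
    have hmono : Monotone (Fin.elim0 : Fin 0 → ℕ) := fun i => i.elim0
    simp [potentialBound, this, weight, hmono]
    ring
  · have hIcc : ∀ {p m' : ℕ} {k : Fin p → ℕ}, k ∈ tuples n p m' → ∀ i, k i ∈ Finset.Icc 1 n := by
      intro p m' k hk
      rw [tuples, Finset.mem_filter, Fintype.mem_piFinset] at hk
      exact hk.1
    have hsumH := WordBound.sum (Finset.Icc 2 m) fun p hp => WordBound.sum (tuples n p m)
      fun k hk => wordBound_weight_nested hn le_rfl hH hk (b := b) (S := S) fun i =>
        hS _ (hIcc hk i) (lt_of_mem_tuples hk (Finset.mem_Icc.mp hp).1 i)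
    have hsumT := WordBound.sum (Finset.Icc 1 (m - 1)) fun p hp =>
      WordBound.sum (tuples n p (m - 1))
      fun k hk => wordBound_weight_nested hn one_le_two hT hk (b := b) (S := S) fun i =>
        hS _ (hIcc hk i) (by have := le_of_mem_tuples hk i; omega)
    have hr1 : 1 + m = m + 1 := by omega
    have hr2 : 2 + (m - 1) = m + 1 := by omega
    rw [hr1] at hsumH
    rw [hr2] at hsumT
    refine (hsumH.add hsumT).mono (le_of_eq ?_)
    have hrange : Finset.range m = insert 0 (Finset.Icc 1 (m - 1)) := by
      ext p
      simp only [Finset.mem_range, Finset.mem_insert, Finset.mem_Icc]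
      omega
    have hempty : tuples n 0 (m - 1) = ∅ := by
      rw [tuples, Finset.filter_eq_empty_iff]
      intro k _ hk
      rw [Fin.sum_univ_zero] at hk
      omega
    rw [potentialBound, hrange, Finset.sum_insert (by simp), hempty, Finset.sum_empty, zero_add,
      mul_add]
    simp only [← Finset.mul_sum, Nat.factorial_one, Nat.factorial_two, Nat.cast_one, div_one,
      Nat.cast_ofNat]
    ring

theorem potentialBound_congr (n : ℕ) {b b' : ℕ → ℝ} {m : ℕ} (h : ∀ a < m, b a = b' a) :
    potentialBound n b m = potentialBound n b' m := by
  rw [potentialBound, potentialBound]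
  refine congrArg₂ (· + ·) ?_ (congrArg _ ?_)
  · refine Finset.sum_congr rfl fun p hp => Finset.sum_congr rfl fun k hk => ?_
    rw [Finset.prod_congr rfl fun i _ => h _ (lt_of_mem_tuples hk (Finset.mem_Icc.mp hp).1 i)]
  · refine Finset.sum_congr rfl fun p hp => Finset.sum_congr rfl fun k hk => ?_
    rw [Finset.prod_congr rfl fun i _ => h _ ?_]
    have h1 := le_of_mem_tuples hk i
    have h2 := Finset.mem_range.mp hp
    have h3 := i.2
    omega

theorem potentialBound_nonneg (n : ℕ) {b : ℕ → ℝ} (hb : ∀ a, 0 ≤ b a) (m : ℕ) :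
    0 ≤ potentialBound n b m := by
  have : ∀ {p : ℕ} (k : Fin p → ℕ), 0 ≤ ∏ i, b (k i) := fun k =>
    Finset.prod_nonneg fun i _ => hb _
  refine add_nonneg (Finset.sum_nonneg fun p _ => Finset.sum_nonneg fun k _ => ?_)
    (mul_nonneg (by norm_num) (Finset.sum_nonneg fun p _ => Finset.sum_nonneg fun k _ => ?_)) <;>
  · have := this k
    positivity

/-- The majorant of the atomic norms of the potentials `V_m / Γ`: the solution of the recursion
`b m = potentialBound n b m`, whose right-hand side depends on the values of `b` below `m` only. -/
noncomputable def majorant (n : ℕ) (m : ℕ) : ℝ :=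
  potentialBound n (fun k => if _ : k < m then majorant n k else 0) m
termination_by m

theorem majorant_eq (n m : ℕ) : majorant n m = potentialBound n (majorant n) m := by
  rw [majorant]
  exact potentialBound_congr n fun a ha => by rw [dif_pos ha]

theorem majorant_nonneg (n m : ℕ) : 0 ≤ majorant n m := by
  induction m using Nat.strong_induction_on with
  | _ m ih =>
    rw [majorant]
    refine potentialBound_nonneg n (fun a => ?_) m
    split_ifs with h
    · exact ih a h
    · exact le_rfl

/-- A weighted sum over tuples of length `p` whose entries add up to one of the distinct degrees
`g m` is part of the `p`-th term of an exponential series. Only the entries that occur have to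
satisfy `y a = b a * x ^ a`, so that `y` can be truncated. -/
theorem sum_sum_tuples_le (n p : ℕ) {b y : ℕ → ℝ} {x : ℝ} (hy : ∀ a, 0 ≤ y a) (s : Finset ℕ)
    (g : ℕ → ℕ) (hg : Set.InjOn g s)
    (hby : ∀ m ∈ s, ∀ k ∈ tuples n p (g m), ∀ i, y (k i) = b (k i) * x ^ k i) :
    ∑ m ∈ s, x ^ g m * ∑ k ∈ tuples n p (g m), ‖weight n k‖ * ∏ i, b (k i) ≤
      (∑ l ∈ Finset.Icc 1 n, y l) ^ p / p.factorial := by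
  rw [← sum_weight_mul_prod]
  have h1 : ∀ m ∈ s, x ^ g m * ∑ k ∈ tuples n p (g m), ‖weight n k‖ * ∏ i, b (k i) =
      ∑ k ∈ Fintype.piFinset fun _ : Fin p => Finset.Icc 1 n,
        if ∑ i, k i = g m then ‖weight n k‖ * ∏ i, y (k i) else 0 := by
    intro m hm
    rw [← Finset.sum_filter, Finset.mul_sum]
    refine Finset.sum_congr rfl fun k hk => ?_
    rw [Finset.prod_congr rfl fun i _ => hby m hm k hk i, Finset.prod_mul_distrib,
      Finset.prod_pow_eq_pow_sum, (Finset.mem_filter.mp hk).2]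
    ring
  rw [Finset.sum_congr rfl h1, Finset.sum_comm]
  refine Finset.sum_le_sum fun k _ => ?_
  have h0 : 0 ≤ ‖weight n k‖ * ∏ i, y (k i) :=
    mul_nonneg (norm_nonneg _) (Finset.prod_nonneg fun i _ => hy _)
  by_cases h : ∃ m ∈ s, ∑ i, k i = g m
  · obtain ⟨m, hm, hk⟩ := h
    rw [Finset.sum_eq_single_of_mem m hm fun m' hm' hne => if_neg fun h' =>
      hne (hg hm' hm (by rw [← h', hk]))]
    rw [if_pos hk]
  · rw [Finset.sum_eq_zero fun m hm => if_neg fun h' => h ⟨m, hm, h'⟩]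
    exact h0

/-- The ratio of consecutive terms is at most `(4 / 3) * (1 / 10) = 2 / 15` from `p = 2` on. -/
theorem sum_succ_mul_pow_le {u : ℝ} (hu : 0 ≤ u) (hu' : u ≤ 1 / 10) (M : ℕ) :
    ∑ p ∈ Finset.Icc 2 M, ((p : ℝ) + 1) * u ^ p ≤ 45 / 13 * u ^ 2 := by
  have hterm : ∀ q : ℕ, ((q : ℝ) + 3) * u ^ q ≤ 3 * (2 / 15) ^ q := by
    intro q
    induction q with
    | zero => norm_num
    | succ q ih =>
      have h0 : 0 ≤ ((q : ℝ) + 3) * u ^ q := by positivity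
      have h1 : ((q : ℝ) + 4) * u ≤ 2 / 15 * (q + 3) := by
        nlinarith [(Nat.cast_nonneg q : (0:ℝ) ≤ q)]
      have h2 : 0 ≤ u ^ q := by positivity
      push_cast
      rw [pow_succ, pow_succ]
      nlinarith [mul_le_mul_of_nonneg_right h1 h2]
  have hgeom : ∑ q ∈ Finset.range (M - 1), (2 / 15 : ℝ) ^ q ≤ 15 / 13 := by
    have h := Summable.sum_le_tsum (Finset.range (M - 1)) (fun q _ => by positivity)
      (summable_geometric_of_lt_one (by norm_num) (by norm_num : (2 / 15 : ℝ) < 1))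
    rw [tsum_geometric_of_lt_one (by norm_num) (by norm_num)] at h
    norm_num at h ⊢
    exact h
  have hre : ∑ p ∈ Finset.Icc 2 M, ((p : ℝ) + 1) * u ^ p =
      ∑ q ∈ Finset.range (M - 1), ((q : ℝ) + 3) * u ^ q * u ^ 2 := by
    have : Finset.Icc 2 M = Finset.Ico 2 (M + 1) := by ext; simp
    rw [this, Finset.sum_Ico_eq_sum_range]
    refine Finset.sum_congr (by congr 1) fun q _ => ?_
    push_cast
    ring
  rw [hre, ← Finset.sum_mul]
  refine mul_le_mul_of_nonneg_right ?_ (by positivity)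
  calc _ ≤ ∑ q ∈ Finset.range (M - 1), 3 * (2 / 15 : ℝ) ^ q := Finset.sum_le_sum fun q _ => hterm q
    _ ≤ _ := by rw [← Finset.mul_sum]; linarith

/-- The ratio of consecutive terms is at most `3 * (1 / 10)`. -/
theorem sum_choose_mul_pow_le {u : ℝ} (hu : 0 ≤ u) (hu' : u ≤ 1 / 10) (M : ℕ) :
    ∑ p ∈ Finset.range M, ((p : ℝ) + 1) * (p + 2) / 2 * u ^ p ≤ 10 / 7 := by
  have hterm : ∀ q : ℕ, ((q : ℝ) + 1) * (q + 2) / 2 * u ^ q ≤ (3 / 10) ^ q := by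
    intro q
    induction q with
    | zero => norm_num
    | succ q ih =>
      have h1 : ((q : ℝ) + 3) * u ≤ 3 / 10 * (q + 1) := by
        nlinarith [(Nat.cast_nonneg q : (0:ℝ) ≤ q)]
      have h2 : 0 ≤ ((q : ℝ) + 2) / 2 * u ^ q := by positivity
      push_cast
      rw [pow_succ, pow_succ]
      nlinarith [mul_le_mul_of_nonneg_right h1 h2]
  have h := Summable.sum_le_tsum (Finset.range M) (fun q _ => by positivity)
    (summable_geometric_of_lt_one (by norm_num) (by norm_num : (3 / 10 : ℝ) < 1))
  rw [tsum_geometric_of_lt_one (by norm_num) (by norm_num)] at h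
  refine (Finset.sum_le_sum fun q _ => hterm q).trans (h.trans (by norm_num))

/-- If the weighted sum of the bounds below degree `M` is at most `1 / (10 n²)`, then so is the
weighted sum of the resulting bounds on the potentials up to degree `M`. -/
theorem sum_potentialBound_le {n : ℕ} (hn : 1 ≤ n) {b : ℕ → ℝ} (hb : ∀ a, 0 ≤ b a) (M : ℕ)
    (hY : ∑ l ∈ Finset.Icc 1 n, (if l < M then b l * (1 / (230 * (n : ℝ) ^ 2)) ^ l else 0) ≤
      1 / (10 * (n : ℝ) ^ 2)) :
    ∑ m ∈ Finset.Icc 1 M, potentialBound n b m * (1 / (230 * (n : ℝ) ^ 2)) ^ m ≤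
      1 / (10 * (n : ℝ) ^ 2) := by
  have hn1 : (1 : ℝ) ≤ n := by exact_mod_cast hn
  set x : ℝ := 1 / (230 * (n : ℝ) ^ 2) with hx
  have hx0 : 0 ≤ x := by positivity
  set y : ℕ → ℝ := fun l => if l < M then b l * x ^ l else 0 with hy
  have hy0 : ∀ a, 0 ≤ y a := fun a => by
    simp only [hy]
    split_ifs
    · exact mul_nonneg (hb a) (by positivity)
    · exact le_rfl
  set Y := ∑ l ∈ Finset.Icc 1 n, y l with hYdef
  have hY0 : 0 ≤ Y := Finset.sum_nonneg fun l _ => hy0 l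
  have hprod : ∀ {p : ℕ} (k : Fin p → ℕ), 0 ≤ ‖weight n k‖ * ∏ i, b (k i) := fun k =>
    mul_nonneg (norm_nonneg _) (Finset.prod_nonneg fun i _ => hb _)
  have hu0 : 0 ≤ n * Y := by positivity
  have hu2 : n * Y ≤ 1 / (10 * n) := by
    calc n * Y ≤ n * (1 / (10 * (n : ℝ) ^ 2)) := mul_le_mul_of_nonneg_left hY (by positivity)
      _ = 1 / (10 * n) := by field_simp
  have hu1 : n * Y ≤ 1 / 10 := hu2.trans (one_div_le_one_div_of_le (by norm_num) (by linarith))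
  -- the commutators with `H₀`
  have hA : ∑ m ∈ Finset.Icc 1 M, (∑ p ∈ Finset.Icc 2 m, ∑ k ∈ tuples n p m,
      ‖weight n k‖ * ((p + 1).factorial * (n : ℝ) ^ p * ∏ i, b (k i))) * x ^ m ≤
      ∑ p ∈ Finset.Icc 2 M, ((p : ℝ) + 1) * (n * Y) ^ p := by
    calc _ ≤ ∑ m ∈ Finset.Icc 1 M, ∑ p ∈ Finset.Icc 2 M, ((p + 1).factorial * (n : ℝ) ^ p) *
          (x ^ m * ∑ k ∈ tuples n p m, ‖weight n k‖ * ∏ i, b (k i)) := by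
          refine Finset.sum_le_sum fun m hm => ?_
          rw [Finset.sum_mul]
          refine le_trans (le_of_eq ?_) (Finset.sum_le_sum_of_subset_of_nonneg
            (Finset.Icc_subset_Icc_right (Finset.mem_Icc.mp hm).2) fun p _ _ => ?_)
          · refine Finset.sum_congr rfl fun p _ => ?_
            rw [Finset.sum_mul, Finset.mul_sum, Finset.mul_sum]
            exact Finset.sum_congr rfl fun k _ => by ring
          · exact mul_nonneg (by positivity)
              (mul_nonneg (by positivity) (Finset.sum_nonneg fun k _ => hprod k))
      _ ≤ _ := by
          rw [Finset.sum_comm]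
          refine Finset.sum_le_sum fun p hp => ?_
          rw [← Finset.mul_sum]
          have h := sum_sum_tuples_le n p (b := b) (x := x) hy0 (Finset.Icc 1 M) id
            Function.injective_id.injOn fun m hm k hk i => by
              have h1 := lt_of_mem_tuples hk (Finset.mem_Icc.mp hp).1 i
              have h2 := (Finset.mem_Icc.mp hm).2
              simp only [id] at h1
              simp only [hy]
              rw [if_pos (by omega)]
          refine (mul_le_mul_of_nonneg_left h (by positivity)).trans (le_of_eq ?_)
          rw [Nat.factorial_succ, mul_pow]
          have : (p.factorial : ℝ) ≠ 0 := Nat.cast_ne_zero.mpr (Nat.factorial_ne_zero p)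
          push_cast
          field_simp
          rfl
  -- the commutators with `T`
  have hB : ∑ m ∈ Finset.Icc 1 M, (10 * ∑ p ∈ Finset.range m, ∑ k ∈ tuples n p (m - 1),
      ‖weight n k‖ * ((p + 2).factorial / 2 * (n : ℝ) ^ p * ∏ i, b (k i))) * x ^ m ≤
      10 * x * ∑ p ∈ Finset.range M, ((p : ℝ) + 1) * (p + 2) / 2 * (n * Y) ^ p := by
    calc _ ≤ ∑ m ∈ Finset.Icc 1 M, ∑ p ∈ Finset.range M,
          (10 * x * ((p + 2).factorial / 2 * (n : ℝ) ^ p)) *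
          (x ^ (m - 1) * ∑ k ∈ tuples n p (m - 1), ‖weight n k‖ * ∏ i, b (k i)) := by
          refine Finset.sum_le_sum fun m hm => ?_
          have hm' := Finset.mem_Icc.mp hm
          rw [Finset.mul_sum, Finset.sum_mul]
          refine le_trans (le_of_eq ?_) (Finset.sum_le_sum_of_subset_of_nonneg
            (Finset.range_subset_range.mpr hm'.2) fun p _ _ => ?_)
          · refine Finset.sum_congr rfl fun p _ => ?_
            rw [Finset.mul_sum, Finset.sum_mul, Finset.mul_sum, Finset.mul_sum]
            refine Finset.sum_congr rfl fun k _ => ?_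
            have : x ^ m = x * x ^ (m - 1) := by rw [← pow_succ', Nat.sub_add_cancel hm'.1]
            rw [this]
            ring
          · exact mul_nonneg (by positivity)
              (mul_nonneg (by positivity) (Finset.sum_nonneg fun k _ => hprod k))
      _ ≤ _ := by
          rw [Finset.sum_comm, Finset.mul_sum]
          refine Finset.sum_le_sum fun p hp => ?_
          rw [← Finset.mul_sum]
          have h := sum_sum_tuples_le n p (b := b) (x := x) hy0 (Finset.Icc 1 M) (fun m => m - 1)
            (fun m hm m' hm' h => by
              have h1 := (Finset.mem_Icc.mp hm).1
              have h2 := (Finset.mem_Icc.mp hm').1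
              simp only at h
              omega) fun m hm k hk i => by
              have h1 := le_of_mem_tuples hk i
              have h2 := Finset.mem_Icc.mp hm
              simp only [hy]
              rw [if_pos (by omega)]
          refine (mul_le_mul_of_nonneg_left h (by positivity)).trans (le_of_eq ?_)
          rw [Nat.factorial_succ, Nat.factorial_succ, mul_pow]
          have : (p.factorial : ℝ) ≠ 0 := Nat.cast_ne_zero.mpr (Nat.factorial_ne_zero p)
          push_cast
          field_simp
          ring
  simp only [potentialBound, add_mul, Finset.sum_add_distrib]
  have h1 := hA.trans (sum_succ_mul_pow_le hu0 hu1 M)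
  have h2 := hB.trans (mul_le_mul_of_nonneg_left (sum_choose_mul_pow_le hu0 hu1 M)
    (by positivity))
  have h3 : (n * Y) ^ 2 ≤ 1 / 100 * (1 / (n : ℝ) ^ 2) := by
    calc (n * Y) ^ 2 ≤ (1 / (10 * n)) ^ 2 := pow_le_pow_left₀ hu0 hu2 2
      _ = _ := by rw [div_pow, mul_pow]; field_simp; norm_num
  have h4 : x = 1 / 230 * (1 / (n : ℝ) ^ 2) := by rw [hx]; field_simp
  have h5 : 1 / (10 * (n : ℝ) ^ 2) = 1 / 10 * (1 / (n : ℝ) ^ 2) := by field_simp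
  have h6 : 0 ≤ 1 / (n : ℝ) ^ 2 := by positivity
  refine (add_le_add h1 h2).trans ?_
  rw [h5, h4]
  linarith

theorem sum_majorant_le {n : ℕ} (hn : 1 ≤ n) (M : ℕ) :
    ∑ m ∈ Finset.Icc 1 M, majorant n m * (1 / (230 * (n : ℝ) ^ 2)) ^ m ≤
      1 / (10 * (n : ℝ) ^ 2) := by
  have hn1 : (1 : ℝ) ≤ n := by exact_mod_cast hn
  have h0 : ∀ l, 0 ≤ majorant n l * (1 / (230 * (n : ℝ) ^ 2)) ^ l := fun l =>
    mul_nonneg (majorant_nonneg n l) (by positivity)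
  induction M with
  | zero => simp
  | succ M ih =>
    rw [Finset.sum_congr rfl fun m _ => by rw [majorant_eq]]
    refine sum_potentialBound_le hn (majorant_nonneg n) (M + 1) (le_trans ?_ ih)
    rw [← Finset.sum_filter]
    refine Finset.sum_le_sum_of_subset_of_nonneg (fun l hl => ?_) fun l _ _ => h0 l
    rw [Finset.mem_filter, Finset.mem_Icc] at hl
    rw [Finset.mem_Icc]
    omega

theorem majorant_le {n : ℕ} (hn : 1 ≤ n) {m : ℕ} (hm : 1 ≤ m) :
    majorant n m ≤ 1 / 10 * (230 * (n : ℝ) ^ 2) ^ m := by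
  have hn1 : (1 : ℝ) ≤ n := by exact_mod_cast hn
  have h := (Finset.single_le_sum
    (f := fun l => majorant n l * (1 / (230 * (n : ℝ) ^ 2)) ^ l) (fun l _ =>
      mul_nonneg (majorant_nonneg n l) (by positivity))
    (Finset.mem_Icc.mpr ⟨hm, le_rfl⟩)).trans (sum_majorant_le hn m)
  have h2 : 1 / (10 * (n : ℝ) ^ 2) ≤ 1 / 10 :=
    one_div_le_one_div_of_le (by norm_num) (by nlinarith)
  simp only [div_pow, one_pow, mul_one_div] at h
  rw [div_le_iff₀ (by positivity)] at h
  exact h.trans (mul_le_mul_of_nonneg_right h2 (by positivity))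

/-- Passing from the atomic norm to the Frobenius norm costs a factor `m + 1`, which is absorbed by
the step from `230` to `263`. -/
theorem succ_mul_majorant_le {n : ℕ} (hn : 1 ≤ n) {m : ℕ} (hm : 1 ≤ m) :
    ((m : ℝ) + 1) * majorant n m ≤ (263 * (n : ℝ) ^ 2) ^ m := by
  have hbern := one_add_mul_le_pow (a := (33 / 230 : ℝ)) (by norm_num) m
  have h1 : ((m : ℝ) + 1) / 10 ≤ (263 / 230) ^ m := by
    have : (1 : ℝ) + 33 / 230 = 263 / 230 := by norm_num
    rw [this] at hbern
    have hm0 : (0 : ℝ) ≤ m := Nat.cast_nonneg m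
    linarith
  calc ((m : ℝ) + 1) * majorant n m ≤ (m + 1) * (1 / 10 * (230 * (n : ℝ) ^ 2) ^ m) :=
        mul_le_mul_of_nonneg_left (majorant_le hn hm) (by positivity)
    _ = ((m : ℝ) + 1) / 10 * (230 * (n : ℝ) ^ 2) ^ m := by ring
    _ ≤ (263 / 230) ^ m * (230 * (n : ℝ) ^ 2) ^ m :=
        mul_le_mul_of_nonneg_right h1 (by positivity)
    _ = (263 * (n : ℝ) ^ 2) ^ m := by rw [← mul_pow]; congr 1; ring

end SW

/-! ### Estimates for the local Schrieffer-Wolff transformation -/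

namespace SW

open TIOp

/-- Every Hermitian operator lies in some window, hence has an expansion into products of letters,
and these are eigenvectors of `ad_{H₀}`. -/
theorem exists_isSplitting {v : Pauli → ℝ} (hv : v Pauli.I = 0) (h1 : ∑ a, v a * v a = 1) {Γ : ℝ}
    (hΓ : 0 < Γ) {V : TIOp} (hV : V.IsHermitian) :
    ∃ x, IsSplitting (ad ((Γ : ℂ) • site (Pauli.vecMat v))) V x := by
  obtain ⟨M, hM, hmem⟩ := exists_mem_ofRange V
  obtain ⟨x, y, w, h2, h3, h4, -⟩ :=
    (WordBound.of_mem_ofRange hv h1 hmem hV).exists_pseudoinverse hM hΓ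
  exact ⟨x, y, w, h2, h3, h4⟩

theorem isHermitian_generatorsUpTo {v : Pauli → ℝ} (hv : v Pauli.I = 0)
    (h1 : ∑ a, v a * v a = 1) {Γ : ℝ} (hΓ : 0 < Γ) {H₀ T : TIOp}
    (hH : H₀ = (Γ : ℂ) • site (Pauli.vecMat v)) (hHherm : H₀.IsHermitian) (hT : T.IsHermitian)
    (n N a : ℕ) : (generatorsUpTo n H₀ T N a).IsHermitian := by
  have hz := Pauli.isSelfAdjoint_vecMat v
  induction N generalizing a with
  | zero => intro; simp [generatorsUpTo]
  | succ N ih =>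
    rw [generatorsUpTo]
    by_cases ha : a = N + 1
    · subst ha
      rw [Function.update_self]
      have hV := isHermitian_potentialOf n hHherm hT ih (N + 1)
      obtain ⟨x, hx⟩ := exists_isSplitting hv h1 hΓ hV
      rw [← hH] at hx
      subst hH
      rw [pseudoinverse_eq (hx.isPseudoinverseAt Γ hz)]
      exact hx.isHermitian Γ hz hHherm hV
    · rw [Function.update_of_ne ha]
      exact ih a

theorem iad_neg_I_smul (x H : TIOp) : iad (-Complex.I • x) H = -ad H x := by
  rw [iad, map_smul, LinearMap.smul_apply, LinearMap.smul_apply, smul_smul, ad_swap x H]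
  simp

theorem wordBound_smul_site {v : Pauli → ℝ} (hv : v Pauli.I = 0) (h1 : ∑ a, v a * v a = 1) {Γ : ℝ}
    (hΓ : 0 < Γ) : WordBound (Pauli.vecMat v) 1 Γ ((Γ : ℂ) • site (Pauli.vecMat v)) := by
  have h := WordBound.word (z := Pauli.vecMat v) (M := 1)
    (Function.update 1 0 (Pauli.vecMat v)) (fun j => ?_) fun j hj => ?_
  · have h2 := h.smul (Γ : ℂ)
    rw [Complex.norm_real, Real.norm_of_nonneg hΓ.le, mul_one] at h2
    exact h2
  · by_cases hj : j = 0
    · subst hj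
      rw [Function.update_self]
      exact isLetter_self (Pauli.norm_vecMat_le hv h1)
    · rw [Function.update_of_ne hj]
      exact isLetter_one
  · rw [Function.update_of_ne]
    · rfl
    · rintro rfl
      simp at hj

/-- The potentials and the generators are bounded by the majorant. -/
theorem wordBound_potential {v : Pauli → ℝ} (hv : v Pauli.I = 0) (h1 : ∑ a, v a * v a = 1) {Γ : ℝ}
    (hΓ : 0 < Γ) {T : TIOp} (hT : T ∈ ofRange 2) (hTherm : T.IsHermitian)
    (hTnorm : ‖toHilbert T‖ = Γ) {n : ℕ} (hn : 1 ≤ n) {m : ℕ} (hm : 1 ≤ m) :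
    WordBound (Pauli.vecMat v) (m + 1) (Γ * majorant n m)
      (potential n ((Γ : ℂ) • site (Pauli.vecMat v)) T m) := by
  have hz := Pauli.isSelfAdjoint_vecMat v
  have hT2 : WordBound (Pauli.vecMat v) 2 (10 * Γ) T := by
    have h := WordBound.of_mem_ofRange hv h1 hT hTherm
    rwa [hTnorm, Real.sqrt_sq (by norm_num)] at h
  induction m using Nat.strong_induction_on with
  | _ m ih =>
    rw [majorant_eq]
    refine wordBound_potentialOf hn (wordBound_smul_site hv h1 hΓ) hT2 hm fun a ha ham => ?_
    have ha' := Finset.mem_Icc.mp ha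
    obtain ⟨x, y, w, h2, h3, h4, h5⟩ := (ih a ham ha'.1).exists_pseudoinverse (by omega) hΓ
    have hx : IsSplitting _ _ x := ⟨y, w, h2, h3, h4⟩
    rw [generator_eq n _ T ha'.1 ha'.2, pseudoinverse_eq (hx.isPseudoinverseAt Γ hz)]
    refine (h5.smul (-Complex.I)).mono (le_of_eq ?_)
    rw [norm_neg, Complex.norm_I, one_mul]
    field_simp

theorem rotatedCoeff_zero (n : ℕ) (H₀ T : TIOp) : rotatedCoeff n H₀ T 0 = H₀ := by
  rw [rotatedCoeff, coeff_formalRotation]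
  simp [sum_tuples_zero]

/-- The single generator `S_m` acting on `H₀` is the only term of the expansion of `H'` at degree `m`
which is not part of `V_m`. -/
theorem rotatedCoeff_eq (n : ℕ) (H₀ T : TIOp) {m : ℕ} (hm : 1 ≤ m) :
    rotatedCoeff n H₀ T m =
      (if m ∈ Finset.Icc 1 n then iad (generator n H₀ T m) H₀ else 0) + potential n H₀ T m := by
  obtain ⟨l, rfl⟩ : ∃ l, m = l + 1 := ⟨m - 1, by omega⟩
  exact coeff_formalRotation_apply n H₀ T _ hm

theorem hasSum_geometric_tail (n : ℕ) {r : ℝ} (h0 : 0 ≤ r) (h1 : r < 1) :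
    HasSum (fun m : {m : ℕ // n < m} => r ^ (m : ℕ)) (r ^ (n + 1) * (1 - r)⁻¹) := by
  let e : ℕ ≃ {m : ℕ // n < m} :=
    { toFun := fun k => ⟨n + 1 + k, by omega⟩
      invFun := fun m => m - (n + 1)
      left_inv := fun k => by simp
      right_inv := fun m => Subtype.ext (by have := m.2; simp; omega) }
  rw [← e.hasSum_iff]
  have h := (hasSum_geometric_of_lt_one h0 h1).mul_left (r ^ (n + 1))
  have he : (fun m : {m : ℕ // n < m} => r ^ (m : ℕ)) ∘ e = fun k => r ^ (n + 1) * r ^ k :=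
    funext fun k => pow_add _ _ _
  rwa [he]

end SW

theorem mainTheorem2 (n : ℕ) (hn : 1 ≤ n) (Γ : ℝ) (hΓ : 0 < Γ) (H₀ T : TIOp)
    (hH₀ : H₀ ∈ TIOp.ofRange 1) (hT : T ∈ TIOp.ofRange 2)
    (hH₀_herm : H₀.IsHermitian) (hT_herm : T.IsHermitian)
    (hH₀_norm : ‖TIOp.toHilbert H₀‖ = Γ) (hT_norm : ‖TIOp.toHilbert T‖ = Γ) :
    -- the generators are Hermitian, orthogonal to the kernel of `ad H₀`, and solve
    -- `i ad_{S_m} (H₀) + V_m = V_m^diag`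
    (∀ m, 1 ≤ m → m ≤ n →
      (SW.generator n H₀ T m).IsHermitian ∧
      SW.IsPseudoinverseAt (TIOp.ad H₀) (SW.potential n H₀ T m)
        (Complex.I • SW.generator n H₀ T m) ∧
      TIOp.ad H₀ (TIOp.iad (SW.generator n H₀ T m) H₀ + SW.potential n H₀ T m) = 0) ∧
    -- the formal expansion `H' = H₀ + ∑_{m=1}^n εᵐ (i ad_{S_m} (H₀) + V_m) + ∑_{m>n} εᵐ V_m`
    (SW.rotatedCoeff n H₀ T 0 = H₀ ∧
      (∀ m, 1 ≤ m → m ≤ n → SW.rotatedCoeff n H₀ T m =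
        TIOp.iad (SW.generator n H₀ T m) H₀ + SW.potential n H₀ T m) ∧
      ∀ m, n < m → SW.rotatedCoeff n H₀ T m = SW.potential n H₀ T m) ∧
    -- the bound on the potentials
    (∀ m, n < m → ‖TIOp.toHilbert (SW.potential n H₀ T m)‖ ≤ Γ * (SW.rho n)⁻¹ ^ m) ∧
    -- convergence of the remainder, and the bound on it
    (∀ ε : ℝ, 0 ≤ ε → ε / SW.rho n ≤ 1 / 2 →
      Summable (fun m : {m : ℕ // n < m} =>
        ((ε : ℂ) ^ (m : ℕ)) • TIOp.toHilbert (SW.potential n H₀ T m)) ∧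
      ‖SW.remainder n H₀ T ε‖ ≤ 2 * Γ * (ε / SW.rho n) ^ (n + 1) ∧
      ‖SW.remainder n H₀ T ε‖ ≤ 2 * Γ * (263 * ((n : ℝ) ^ 2 * ε)) ^ (n + 1)) ∧
    Asymptotics.IsBigO (nhdsWithin 0 (Set.Ici 0)) (fun ε : ℝ => SW.remainder n H₀ T ε)
      (fun ε : ℝ => ((n : ℝ) ^ 2 * ε) ^ (n + 1)) := by
  obtain ⟨v, hv, hv1, hH⟩ := TIOp.exists_eq_smul_site hΓ hH₀ hH₀_herm hH₀_norm
  have hz := Pauli.isSelfAdjoint_vecMat v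
  have hn1 : (1 : ℝ) ≤ n := by exact_mod_cast hn
  have hρ : (SW.rho n)⁻¹ = 263 * (n : ℝ) ^ 2 := by rw [SW.rho, one_div, inv_inv]
  have hherm : ∀ a, (SW.generator n H₀ T a).IsHermitian := fun a =>
    SW.isHermitian_generatorsUpTo hv hv1 hΓ hH hH₀_herm hT_herm n n a
  have hbound : ∀ m, n < m →
      ‖TIOp.toHilbert (SW.potential n H₀ T m)‖ ≤ Γ * (SW.rho n)⁻¹ ^ m := by
    intro m hm
    have h := (SW.wordBound_potential hv hv1 hΓ hT hT_herm hT_norm hn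
      (m := m) (by omega)).norm_le
    rw [← hH] at h
    have h2 := SW.succ_mul_majorant_le hn (m := m) (by omega)
    rw [hρ]
    refine h.trans (le_trans (le_of_eq ?_) (mul_le_mul_of_nonneg_left h2 hΓ.le))
    push_cast
    ring
  have hterm : ∀ ε : ℝ, 0 ≤ ε → ∀ m : {m : ℕ // n < m},
      ‖((ε : ℂ) ^ (m : ℕ)) • TIOp.toHilbert (SW.potential n H₀ T m)‖ ≤
        Γ * (ε / SW.rho n) ^ (m : ℕ) := by
    intro ε hε m
    rw [norm_smul, norm_pow, Complex.norm_real, Real.norm_of_nonneg hε, div_eq_mul_inv, mul_pow,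
      mul_left_comm]
    exact mul_le_mul_of_nonneg_left (hbound m m.2) (by positivity)
  have hρ0 : 0 < SW.rho n := by
    rw [SW.rho]
    positivity
  have hrem : ∀ ε : ℝ, 0 ≤ ε → ε / SW.rho n ≤ 1 / 2 →
      Summable (fun m : {m : ℕ // n < m} =>
        ((ε : ℂ) ^ (m : ℕ)) • TIOp.toHilbert (SW.potential n H₀ T m)) ∧
      ‖SW.remainder n H₀ T ε‖ ≤ 2 * Γ * (ε / SW.rho n) ^ (n + 1) := by
    intro ε hε hε2
    have hr0 : 0 ≤ ε / SW.rho n := by positivity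
    have hgeom := (SW.hasSum_geometric_tail n hr0 (by linarith)).mul_left Γ
    refine ⟨Summable.of_norm_bounded hgeom.summable (hterm ε hε), ?_⟩
    refine (tsum_of_norm_bounded hgeom (hterm ε hε)).trans ?_
    have hinv : (1 - ε / SW.rho n)⁻¹ ≤ 2 := by
      rw [inv_le_comm₀ (by linarith) two_pos]
      linarith
    have hp : 0 ≤ Γ * (ε / SW.rho n) ^ (n + 1) := by positivity
    calc Γ * ((ε / SW.rho n) ^ (n + 1) * (1 - ε / SW.rho n)⁻¹)
        = Γ * (ε / SW.rho n) ^ (n + 1) * (1 - ε / SW.rho n)⁻¹ := by ring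
      _ ≤ Γ * (ε / SW.rho n) ^ (n + 1) * 2 := mul_le_mul_of_nonneg_left hinv hp
      _ = 2 * Γ * (ε / SW.rho n) ^ (n + 1) := by ring
  have hrho : ∀ ε : ℝ, ε / SW.rho n = 263 * ((n : ℝ) ^ 2 * ε) := fun ε => by
    rw [div_eq_mul_inv, hρ]
    ring
  refine ⟨fun m hm hmn => ?_, ⟨SW.rotatedCoeff_zero n H₀ T, fun m hm hmn => ?_, fun m hm => ?_⟩,
    hbound, fun ε hε hε2 => ⟨(hrem ε hε hε2).1, (hrem ε hε hε2).2, ?_⟩, ?_⟩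
  · have hV := SW.isHermitian_potentialOf n hH₀_herm hT_herm hherm m
    obtain ⟨x, hx⟩ := SW.exists_isSplitting hv hv1 hΓ hV
    have hpinv := hx.isPseudoinverseAt Γ hz
    rw [← hH] at hx hpinv
    have hgen := SW.generator_eq n H₀ T hm hmn
    rw [SW.potential, SW.pseudoinverse_eq hpinv] at hgen
    refine ⟨hherm m, ?_, ?_⟩
    · have hx' : Complex.I • (-Complex.I • x) = x := by rw [smul_smul]; simp
      rw [hgen, hx']
      exact hpinv
    · obtain ⟨y, w, h1, h2, -⟩ := hx
      rw [hgen, SW.iad_neg_I_smul, SW.potential, h1, neg_add_cancel_left, h2]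
  · rw [SW.rotatedCoeff_eq n H₀ T hm, if_pos (Finset.mem_Icc.mpr ⟨hm, hmn⟩)]
  · rw [SW.rotatedCoeff_eq n H₀ T (by omega), if_neg, zero_add]
    rw [Finset.mem_Icc]
    omega
  · rw [← hrho]
    exact (hrem ε hε hε2).2
  · refine Asymptotics.IsBigO.of_bound (2 * Γ * 263 ^ (n + 1)) ?_
    have hsmall : ∀ᶠ ε : ℝ in nhdsWithin 0 (Set.Ici 0), ε ≤ SW.rho n / 2 :=
      mem_nhdsWithin_of_mem_nhds (Iic_mem_nhds (by positivity))
    filter_upwards [hsmall, self_mem_nhdsWithin] with ε h1 h2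
    have hε : 0 ≤ ε := h2
    refine ((hrem ε hε (by rw [div_le_iff₀ hρ0]; linarith)).2).trans (le_of_eq ?_)
    rw [hrho, mul_pow, Real.norm_of_nonneg (by positivity)]
    ring
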